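/- Throughout, $\|\cdot\|$ is the Euclidean norm, $B(\mathbf x,\rho)$ is the closed ball, $E^{(\varepsilon)}$ is the closed $\varepsilon$-neighbourhood of $E$, $\dim$ is Hausdorff dimension, and all integers $M,N,d$ are at least $1$. **Definitions.** For an $M\times N$ real matrix $A$, let $\mathrm{Bad}_A(M,N)$ be the set of $\mathbf x\in\mathbb R^M$ for which there is $c>0$ such that $\|(A\mathbf q-\mathbf x)-\mathbf p\|>c\|\mathbf q\|^{-N/M}$ for all $\mathbf q\in\mathbb Z^N\setminus\{0\}$ and $\mathbf p\in\mathbb Z^M$. A closed set $K\subseteq\mathbb R^d$ is *hyperplane diffuse* if there are $\beta\in(0,1)$ and $\rho_K>0$ such that for all $0<\rho\le\rho_K$, all $\mathbf x\in K$ and all affine hyperplanes $\mathcal L\subseteq\mathbb R^d$, the set $K\cap B(\mathbf x,\rho)\setminus\mathcal L^{(\beta\rho)}$ is nonempty. Let $K\subseteq\mathbb R^d$ be closed and $0<\alpha,\beta<1$. In the $(\alpha,\beta)$-game on $K$, Bob and Alice alternately choose closed balls $B_1\supseteq A_1\supseteq B_2\supseteq A_2\supseteq\cdots$ of positive radius centred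 at points of $K$ (Bob chooses the $B_i$ and moves first), with radii satisfying $\rho(A_i)=\alpha\rho(B_i)$ and $\rho(B_{i+1})=\beta\rho(A_i)$. A set $S$ is *winning on $K$* if there is $\alpha\in(0,1)$ such that for every $\beta\in(0,1)$ Alice has a strategy in the $(\alpha,\beta)$-game on $K$ which guarantees $\bigcap_i B_i\subseteq S$. A locally finite Borel measure $\mu$ on $\mathbb R^d$ is *Ahlfors regular* if there are $\delta\in\mathbb R$ and $c_1,c_2,\rho_0>0$ with $c_1\rho^\delta\le\mu(B(\mathbf x,\rho))\le c_2\rho^\delta$ for all $\mathbf x\in\operatorname{supp}\mu$ and $0<\rho<\rho_0$. For $U\subseteq\mathbb R^d$ open, a *$C^1$ diffeomorphism* $f:U\to\mathbb R^d$ is an injective $C^1$ map whose image is open and whose inverse $f(U)\to U$ is $C^1$; $f^{-1}(S)$ denotes $\{\mathbf x\in U: f(\mathbf x)\in S\}$. A set $S\subseteq\mathbb R^d$ is *strongly $C^1$ incompressible on $K$* if for every open $U$ with $K\cap U\ne\varnothing$ and every sequence of $C^1$ diffeomorphisms $f_i:U\to\mathbb R^d$, $$\dim\Big(K\cap\bigcap_{i=1}^\infty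 f_i^{-1}(S)\Big)=\dim(K\cap U).$$ **Corollary.** Fix $M,N\ge1$ and a real $M\times N$ matrix $A$, let $S=\mathrm{Bad}_A(M,N)$, and let $K\subseteq\mathbb R^M$ be hyperplane diffuse. 1. For every sequence of $C^1$ diffeomorphisms $f_i:\mathbb R^M\to\mathbb R^M$ onto open subsets, the set $K\cap\bigcap_i f_i^{-1}(S)$ is winning on $K$. More generally, for every open $U\subseteq\mathbb R^M$ and every sequence of $C^1$ diffeomorphisms $f_i:U\to\mathbb R^M$, the set $K\cap\big(\bigcap_i f_i^{-1}(S)\cup(\mathbb R^M\setminus U)\big)$ is winning on $K$. 2. For $U$ and $(f_i)$ as in the last sentence with $K\cap U\neq\varnothing$, we have $\dim\big(K\cap\bigcap_i f_i^{-1}(S)\big)>0$. 3. If moreover $K$ is the support of an Ahlfors regular measure, then $\dim\big(K\cap\bigcap_i f_i^{-1}(S)\big)=\dim(K\cap U)$ for all such $U$ and $(f_i)$. Thus $S$ is strongly $C^1$ incompressible on $K$. -/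

import Mathlib

open Set Metric MeasureTheory

/-- The integer vector `q`, seen in Euclidean space. -/
noncomputable def intVec {n : ℕ} (q : Fin n → ℤ) : EuclideanSpace ℝ (Fin n) :=
  WithLp.toLp 2 (fun j => (q j : ℝ))

/-- The matrix-vector product `A v` for the Euclidean norms. -/
noncomputable def matVec {M N : ℕ} (A : Matrix (Fin M) (Fin N) ℝ)
    (v : EuclideanSpace ℝ (Fin N)) : EuclideanSpace ℝ (Fin M) :=
  WithLp.toLp 2 (A.mulVec (WithLp.ofLp v))

/-- `Bad(M,N)`: the pairs `(A, x)` for which the system of affine forms `q ↦ A q - x` is badly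
approximable. -/
def badAffine (M N : ℕ) : Set (Matrix (Fin M) (Fin N) ℝ × EuclideanSpace ℝ (Fin M)) :=
  {P | ∃ c : ℝ, 0 < c ∧ ∀ q : Fin N → ℤ, q ≠ 0 → ∀ p : Fin M → ℤ,
    c * ‖intVec q‖ ^ (-((N : ℝ) / (M : ℝ))) < ‖(matVec P.1 (intVec q) - P.2) - intVec p‖}

/-- `Bad_A(M,N)`, the slice of `Bad(M,N)` over the matrix `A`. -/
def badSlice {M N : ℕ} (A : Matrix (Fin M) (Fin N) ℝ) : Set (EuclideanSpace ℝ (Fin M)) :=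
  {x | (A, x) ∈ badAffine M N}

/-- `K` is `k`-dimensionally `β`-diffuse. -/
def IsDiffuseWith {d : ℕ} (k : ℕ) (β : ℝ) (K : Set (EuclideanSpace ℝ (Fin d))) : Prop :=
  ∃ ρK : ℝ, 0 < ρK ∧ ∀ ρ : ℝ, 0 < ρ → ρ ≤ ρK → ∀ x ∈ K,
    ∀ L : AffineSubspace ℝ (EuclideanSpace ℝ (Fin d)),
      (L : Set (EuclideanSpace ℝ (Fin d))).Nonempty → Module.finrank ℝ L.direction = k →
      ∃ x' ∈ K, x' ∈ closedBall x ρ \ cthickening (β * ρ) (L : Set (EuclideanSpace ℝ (Fin d)))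

/-- `K ⊆ ℝ^d` is hyperplane diffuse: closed and `(d-1)`-dimensionally `β`-diffuse for some
`β ∈ (0,1)` (used for `d ≥ 1` only). -/
def IsHyperplaneDiffuse {d : ℕ} (K : Set (EuclideanSpace ℝ (Fin d))) : Prop :=
  IsClosed K ∧ ∃ β : ℝ, 0 < β ∧ β < 1 ∧ IsDiffuseWith (d - 1) β K

/-- A move in Schmidt's game: the centre and the radius of a closed ball. -/
abbrev GameBall (d : ℕ) : Type := EuclideanSpace ℝ (Fin d) × ℝ

/-- The closed ball described by a move. -/
def GameBall.set {d : ℕ} (B : GameBall d) : Set (EuclideanSpace ℝ (Fin d)) :=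
  closedBall B.1 B.2

/-- Bob's `n`-th move `b n` is legal in the `(α,β)`-game on `K` (moves are counted from `0`),
given Alice's moves `a`. -/
def BobLegal {d : ℕ} (K : Set (EuclideanSpace ℝ (Fin d))) (β : ℝ) (b a : ℕ → GameBall d) :
    ℕ → Prop
  | 0 => (b 0).1 ∈ K ∧ 0 < (b 0).2
  | n + 1 => (b (n + 1)).1 ∈ K ∧ (b (n + 1)).2 = β * (a n).2 ∧
      (b (n + 1)).set ⊆ (a n).set

/-- Alice's `n`-th move `a n`, made in reply to `b n`, is legal in the `(α,β)`-game on `K`. -/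
def AliceLegal {d : ℕ} (K : Set (EuclideanSpace ℝ (Fin d))) (α : ℝ) (b a : ℕ → GameBall d)
    (n : ℕ) : Prop :=
  (a n).1 ∈ K ∧ (a n).2 = α * (b n).2 ∧ (a n).set ⊆ (b n).set

/-- A strategy for Alice: her `n`-th move as a function of Bob's moves `0, …, n`. -/
abbrev AliceStrategy (d : ℕ) : Type := (n : ℕ) → (Fin (n + 1) → GameBall d) → GameBall d

/-- Alice's moves when she follows `σ` against Bob's moves `b`. -/
def AliceStrategy.reply {d : ℕ} (σ : AliceStrategy d) (b : ℕ → GameBall d) (n : ℕ) :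
    GameBall d :=
  σ n (fun i => b i)

/-- `S` is `(α,β)`-winning on `K`: Alice has a strategy whose moves are legal as long as Bob's
are, and which forces `⋂ Bᵢ ⊆ S` whenever all of Bob's moves are legal. -/
def IsAlphaBetaWinningOn {d : ℕ} (K : Set (EuclideanSpace ℝ (Fin d))) (α β : ℝ)
    (S : Set (EuclideanSpace ℝ (Fin d))) : Prop :=
  ∃ σ : AliceStrategy d, ∀ b : ℕ → GameBall d,
    (∀ n, (∀ m ≤ n, BobLegal K β b (σ.reply b) m) → AliceLegal K α b (σ.reply b) n) ∧
    ((∀ n, BobLegal K β b (σ.reply b) n) → (⋂ n, (b n).set) ⊆ S)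

/-- `S` is `α`-winning on `K`. -/
def IsAlphaWinningOn {d : ℕ} (K : Set (EuclideanSpace ℝ (Fin d))) (α : ℝ)
    (S : Set (EuclideanSpace ℝ (Fin d))) : Prop :=
  ∀ β : ℝ, 0 < β → β < 1 → IsAlphaBetaWinningOn K α β S

/-- `S` is winning on `K` (for Schmidt's game). -/
def IsWinningOn {d : ℕ} (K S : Set (EuclideanSpace ℝ (Fin d))) : Prop :=
  ∃ α : ℝ, 0 < α ∧ α < 1 ∧ IsAlphaWinningOn K α S

/-- The locally finite Borel measure `μ` is `δ`-Ahlfors regular. -/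
def IsAhlforsRegularWith {d : ℕ} (δ : ℝ) (μ : Measure (EuclideanSpace ℝ (Fin d))) : Prop :=
  IsLocallyFiniteMeasure μ ∧ ∃ c₁ c₂ ρ₀ : ℝ, 0 < c₁ ∧ 0 < c₂ ∧ 0 < ρ₀ ∧
    ∀ x ∈ μ.support, ∀ ρ : ℝ, 0 < ρ → ρ < ρ₀ →
      ENNReal.ofReal (c₁ * ρ ^ δ) ≤ μ (closedBall x ρ) ∧
        μ (closedBall x ρ) ≤ ENNReal.ofReal (c₂ * ρ ^ δ)

/-- `μ` is Ahlfors regular. -/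
def IsAhlforsRegular {d : ℕ} (μ : Measure (EuclideanSpace ℝ (Fin d))) : Prop :=
  ∃ δ : ℝ, IsAhlforsRegularWith δ μ

/-- `f` restricts to a `C¹` diffeomorphism of the open set `U` onto an open subset of `ℝ^d`.
The values of `f` outside `U` play no role. -/
def IsC1DiffeoOn {d : ℕ} (U : Set (EuclideanSpace ℝ (Fin d)))
    (f : EuclideanSpace ℝ (Fin d) → EuclideanSpace ℝ (Fin d)) : Prop :=
  ContDiffOn ℝ 1 f U ∧ IsOpen (f '' U) ∧
    ∃ g : EuclideanSpace ℝ (Fin d) → EuclideanSpace ℝ (Fin d),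
      ContDiffOn ℝ 1 g (f '' U) ∧ ∀ x ∈ U, g (f x) = x

/-- `⋂ᵢ fᵢ⁻¹(S)` for maps `fᵢ : U → ℝ^d`; it is a subset of `U`. -/
def pullbackInter {d : ℕ} (U : Set (EuclideanSpace ℝ (Fin d)))
    (f : ℕ → EuclideanSpace ℝ (Fin d) → EuclideanSpace ℝ (Fin d))
    (S : Set (EuclideanSpace ℝ (Fin d))) : Set (EuclideanSpace ℝ (Fin d)) :=
  {x | x ∈ U ∧ ∀ i, f i x ∈ S}

/-- `S` is strongly `C¹` incompressible on `K`. -/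
def IsStronglyC1IncompressibleOn {d : ℕ} (K S : Set (EuclideanSpace ℝ (Fin d))) : Prop :=
  ∀ U : Set (EuclideanSpace ℝ (Fin d)), IsOpen U → (K ∩ U).Nonempty →
    ∀ f : ℕ → EuclideanSpace ℝ (Fin d) → EuclideanSpace ℝ (Fin d),
      (∀ i, IsC1DiffeoOn U (f i)) → dimH (K ∩ pullbackInter U f S) = dimH (K ∩ U)

/-! Transference reduces the problem to a lacunary one. Take in each dyadic shell an integer vector
`y j` for which `Aᵀ y` is as close to an integer vector as possible. If all the numbers `⟪y j, x⟫`
stay a fixed distance away from the integers, then `x` lies in `badSlice A`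
(`exists_dual_sequence`). So Alice has to avoid the preimages under `f` of neighbourhoods of the
parallel hyperplanes `⟪y j, ·⟫ = m`. In a small enough ball of radius at most a constant times `2 ^
(-j)`, such a preimage lies in one thin strip around a hyperplane (`IsC1DiffeoOn.exists_strip`), and
diffuseness lets a single move escape a fixed proportion of any finite weighted family of strips
(`IsHyperplaneDiffuse.exists_avoiding_ball`).

Alice controls a potential: the sum of `2 ^ (-j * s)` over the active strips that meet the current
ball is kept below `Q * r ^ s`. For a suitable `s` the proportion she escapes pays both for the
decrease of `r ^ s` and for the strips that become active. A single term of the sum then shows that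
the `j`-th strip is gone once `r` is below a constant times `2 ^ (-j)`
(`IsHyperplaneDiffuse.exists_isPositionallyWinningOn`). Since `α` depends neither on `f` nor on `U`,
countably many of these strategies can be interleaved (`isWinningOn_of_isPositionallyWinningOn`).

For dimension, Bob chooses among `m` separated balls at each turn; the outcomes form a Cantor set
with a Hölder map onto `[0, 1]` (`IsAlphaBetaWinningOn.le_dimH`). Diffuseness gives `m = 2`, hence
positive dimension; Ahlfors regularity gives enough branches for every exponent below `δ`, while the
support has dimension at most `δ`. -/

/-! ### Transference to the transposed system. -/

section Dual

variable {M N : ℕ}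

/-- The distance, in the maximum norm, from `Aᵀ y` to the nearest integer vector. -/
noncomputable def dualDist (A : Matrix (Fin M) (Fin N) ℝ) (y : Fin M → ℤ) : ℝ :=
  ‖fun k => (∑ i, A i k * y i) - round (∑ i, A i k * (y i : ℝ))‖

theorem dualDist_nonneg (A : Matrix (Fin M) (Fin N) ℝ) (y : Fin M → ℤ) : 0 ≤ dualDist A y :=
  norm_nonneg _

/-- Dirichlet's theorem for the transposed system. -/
theorem exists_dualDist_le (A : Matrix (Fin M) (Fin N) ℝ) (T L : ℕ) (hL : 0 < L)
    (hLT : L ^ N < (T + 1) ^ M) :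
    ∃ y : Fin M → ℤ, y ≠ 0 ∧ ‖y‖ ≤ T ∧ dualDist A y ≤ 1 / L := by
  have hL' : (0 : ℝ) < L := by exact_mod_cast hL
  let t : (Fin M → Fin (T + 1)) → Fin N → ℝ := fun u k => ∑ i, A i k * ((u i : ℕ) : ℝ)
  let F : (Fin M → Fin (T + 1)) → (Fin N → Fin L) := fun u k =>
    ⟨⌊L * Int.fract (t u k)⌋₊, by
      rw [Nat.floor_lt (by positivity)]
      nlinarith [Int.fract_lt_one (t u k)]⟩
  obtain ⟨u, v, huv, hF⟩ := Fintype.exists_ne_map_eq_of_card_lt F (by simpa using hLT)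
  refine ⟨fun i => (u i : ℤ) - (v i : ℤ), ?_, ?_, ?_⟩
  · intro h
    apply huv
    funext i
    have := congrFun h i
    simp only [Pi.zero_apply] at this
    ext
    omega
  · rw [pi_norm_le_iff_of_nonneg (by positivity)]
    intro i
    rw [Int.norm_eq_abs]
    have h1 := (u i).2
    have h2 := (v i).2
    have : |((u i : ℤ) - (v i : ℤ))| ≤ T := by rw [abs_le]; omega
    exact_mod_cast this
  · rw [dualDist, pi_norm_le_iff_of_nonneg (by positivity)]
    intro k
    have hs : (∑ i, A i k * (((u i : ℤ) - (v i : ℤ) : ℤ) : ℝ)) = t u k - t v k := by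
      simp only [t, ← Finset.sum_sub_distrib]
      exact Finset.sum_congr rfl fun i _ => by push_cast; ring
    rw [hs, Real.norm_eq_abs]
    refine (round_le _ (⌊t u k⌋ - ⌊t v k⌋)).trans ?_
    have hk : ⌊L * Int.fract (t u k)⌋₊ = ⌊L * Int.fract (t v k)⌋₊ :=
      congrArg Fin.val (congrFun hF k)
    have e : t u k - t v k - ((⌊t u k⌋ - ⌊t v k⌋ : ℤ) : ℝ)
        = Int.fract (t u k) - Int.fract (t v k) := by
      simp only [Int.fract]; push_cast; ring
    rw [e]
    have a1 := Nat.floor_le (show 0 ≤ L * Int.fract (t u k) by positivity)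
    have a2 := Nat.lt_floor_add_one (L * Int.fract (t u k))
    have b1 := Nat.floor_le (show 0 ≤ L * Int.fract (t v k) by positivity)
    have b2 := Nat.lt_floor_add_one (L * Int.fract (t v k))
    rw [hk] at a1 a2
    rw [le_div_iff₀ hL', ← abs_of_pos hL', ← abs_mul, abs_le]
    constructor <;> nlinarith

theorem one_le_norm_of_ne_zero {n : ℕ} {y : Fin n → ℤ} (hy : y ≠ 0) : 1 ≤ ‖y‖ := by
  obtain ⟨i, hi⟩ := Function.ne_iff.1 hy
  refine le_trans ?_ (norm_le_pi_norm y i)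
  rw [Int.norm_eq_abs]
  exact_mod_cast Int.one_le_abs hi

theorem norm_le_norm_intVec {n : ℕ} (y : Fin n → ℤ) : ‖y‖ ≤ ‖intVec y‖ := by
  rw [pi_norm_le_iff_of_nonneg (norm_nonneg _)]
  intro i
  have := PiLp.norm_apply_le (intVec y) i
  simpa [intVec, Int.norm_eq_abs] using this

theorem norm_intVec_le {n : ℕ} (y : Fin n → ℤ) : ‖intVec y‖ ≤ n * ‖y‖ := by
  have h : intVec y = ∑ i, EuclideanSpace.single i ((y i : ℝ)) := by
    ext j
    simp [intVec, Finset.sum_apply, Pi.single_apply]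
  rw [h]
  refine (norm_sum_le _ _).trans ?_
  have : ∀ i ∈ Finset.univ, ‖EuclideanSpace.single i ((y i : ℝ))‖ ≤ ‖y‖ := by
    intro i _
    rw [PiLp.norm_single]
    simpa [Int.norm_eq_abs] using norm_le_pi_norm y i
  simpa using Finset.sum_le_card_nsmul _ _ _ this

/-- The vectors of the `i`-th dyadic shell, with `Aᵀ y` as close to an integer vector as
possible. -/
theorem exists_shell_minimizer (hM : 1 ≤ M) (A : Matrix (Fin M) (Fin N) ℝ) (i : ℕ) :
    ∃ y : Fin M → ℤ, (2 ^ i ≤ ‖y‖ ∧ ‖y‖ < 2 ^ (i + 1)) ∧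
      ∀ v : Fin M → ℤ, 2 ^ i ≤ ‖v‖ → ‖v‖ < 2 ^ (i + 1) → dualDist A y ≤ dualDist A v := by
  let S : Set (Fin M → ℤ) := {y | 2 ^ i ≤ ‖y‖ ∧ ‖y‖ < 2 ^ (i + 1)}
  have hfin : S.Finite := by
    refine (Set.finite_Icc (fun _ => -2 ^ (i + 1) : Fin M → ℤ) (fun _ => 2 ^ (i + 1))).subset ?_
    intro y hy
    have h : ∀ k, |y k| ≤ 2 ^ (i + 1) := fun k => by
      have := (norm_le_pi_norm y k).trans hy.2.le
      rw [Int.norm_eq_abs] at this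
      exact_mod_cast this
    exact ⟨fun k => (abs_le.1 (h k)).1, fun k => (abs_le.1 (h k)).2⟩
  have hne : S.Nonempty := by
    have : Nonempty (Fin M) := ⟨⟨0, hM⟩⟩
    refine ⟨fun _ => 2 ^ i, ?_⟩
    have : ‖(fun _ => 2 ^ i : Fin M → ℤ)‖ = 2 ^ i := by
      rw [pi_norm_const, Int.norm_eq_abs]
      push_cast
      exact abs_of_pos (by positivity)
    simp only [S, mem_ofPred_eq, this]
    exact ⟨le_rfl, pow_lt_pow_right₀ (by norm_num) (by omega)⟩
  obtain ⟨y, hy, hmin⟩ := Set.exists_min_image S (dualDist A) hfin hne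
  exact ⟨y, hy, fun v h1 h2 => hmin v ⟨h1, h2⟩⟩

/-- Pair `A q - x - p` with `y`: since `⟪y, A q⟫ = ⟪Aᵀ y, q⟫`, replacing `Aᵀ y` by its nearest
integer vector shows that `⟪y, x⟫` differs from an integer by at most the two error terms on the
right. -/
theorem le_dualDist_add (A : Matrix (Fin M) (Fin N) ℝ) (x : EuclideanSpace ℝ (Fin M))
    (y : Fin M → ℤ) (q : Fin N → ℤ) (p : Fin M → ℤ) {c : ℝ}
    (hc : ∀ m : ℤ, c ≤ |inner ℝ (intVec y) x - m|) :
    c ≤ N * dualDist A y * ‖intVec q‖ +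
      ‖intVec y‖ * ‖(matVec A (intVec q) - x) - intVec p‖ := by
  let t : Fin N → ℝ := fun k => ∑ i, A i k * (y i : ℝ)
  have key : inner ℝ (intVec y) x - ((∑ k, round (t k) * q k - ∑ i, y i * p i : ℤ) : ℝ)
      = (∑ k, (t k - round (t k)) * q k)
        - inner ℝ (intVec y) ((matVec A (intVec q) - x) - intVec p) := by
    have h1 : inner ℝ (intVec y) (intVec p) = ∑ i, (y i : ℝ) * p i := by
      simp [intVec, PiLp.inner_apply, mul_comm]
    have h2 : inner ℝ (intVec y) (matVec A (intVec q)) = ∑ k, t k * q k := by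
      simp only [intVec, matVec, PiLp.inner_apply, Matrix.mulVec, dotProduct, t, Finset.sum_mul,
        RCLike.inner_apply, conj_trivial]
      rw [Finset.sum_comm]
      refine Finset.sum_congr rfl fun k _ => Finset.sum_congr rfl fun i _ => by ring
    rw [inner_sub_right, inner_sub_right, h1, h2]
    push_cast
    simp only [sub_mul, Finset.sum_sub_distrib]
    ring
  refine (hc (∑ k, round (t k) * q k - ∑ i, y i * p i)).trans ?_
  rw [key]
  refine (abs_sub _ _).trans (add_le_add ?_ (abs_real_inner_le_norm _ _))
  refine (Finset.abs_sum_le_sum_abs _ _).trans ?_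
  have : ∀ k ∈ Finset.univ, |(t k - round (t k)) * (q k : ℝ)| ≤ dualDist A y * ‖intVec q‖ := by
    intro k _
    rw [abs_mul]
    have h1 : |t k - round (t k)| ≤ dualDist A y :=
      norm_le_pi_norm (fun k => t k - (round (t k) : ℝ)) k
    have h2 : |(q k : ℝ)| ≤ ‖intVec q‖ := by
      have := PiLp.norm_apply_le (intVec q) k
      simpa [intVec] using this
    exact mul_le_mul h1 h2 (abs_nonneg _) (dualDist_nonneg _ _)
  have := Finset.sum_le_card_nsmul _ _ _ this
  simpa [mul_assoc] using this

/-- A lacunary sequence of integer vectors, one in each dyadic shell, such that every `x` whose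
inner products with them stay away from the integers lies in `Bad_A(M,N)`. -/
theorem exists_dual_sequence (hM : 1 ≤ M) (hN : 1 ≤ N) (A : Matrix (Fin M) (Fin N) ℝ) :
    ∃ y : ℕ → EuclideanSpace ℝ (Fin M),
      (∀ j, 2 ^ j ≤ ‖y j‖ ∧ ‖y j‖ ≤ (2 * M) * 2 ^ j) ∧
      ∀ x, (∃ c : ℝ, 0 < c ∧ ∀ j, ∀ m : ℤ, c ≤ |inner ℝ (y j) x - m|) → x ∈ badSlice A := by
  choose y hy hmin using exists_shell_minimizer hM A
  have hM0 : (0 : ℝ) < M := by exact_mod_cast hM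
  have hN0 : (0 : ℝ) < N := by exact_mod_cast hN
  have hyub : ∀ j, ‖intVec (y j)‖ ≤ (2 * M) * 2 ^ j := fun j => by
    refine (norm_intVec_le _).trans ?_
    have := (hy j).2.le
    rw [pow_succ] at this
    nlinarith
  refine ⟨fun j => intVec (y j), fun j => ⟨(hy j).1.trans (norm_le_norm_intVec _), hyub j⟩, ?_⟩
  rintro x ⟨c', hc', hcx'⟩
  obtain ⟨c, hc, hc1, hcx⟩ : ∃ c : ℝ, 0 < c ∧ c ≤ 1 ∧
      ∀ j, ∀ m : ℤ, c ≤ |inner ℝ (intVec (y j)) x - m| :=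
    ⟨min c' 1, by positivity, min_le_right _ _, fun j m => (min_le_left _ _).trans (hcx' j m)⟩
  -- Dirichlet's vector lies in some shell `i ≤ j`, where the minimizer does at least as well. The
  -- factor `2` comes from rounding `X` down.
  have hdir : ∀ j : ℕ, ∃ i ≤ j, dualDist A (y i) ≤ 2 * ((2 : ℝ) ^ j) ^ (-((M : ℝ) / N)) := by
    intro j
    have hj1 : (1 : ℝ) ≤ 2 ^ j := one_le_pow₀ (by norm_num)
    have hX : (1 : ℝ) ≤ ((2 : ℝ) ^ j) ^ ((M : ℝ) / N) :=
      Real.one_le_rpow hj1 (by positivity)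
    set X : ℝ := ((2 : ℝ) ^ j) ^ ((M : ℝ) / N) with hXd
    have hL : 0 < ⌊X⌋₊ := Nat.floor_pos.2 hX
    have hfl : (⌊X⌋₊ : ℝ) ≤ X := Nat.floor_le (by linarith)
    have hLT : ⌊X⌋₊ ^ N < (2 ^ j + 1) ^ M := by
      have h1 : (⌊X⌋₊ : ℝ) ^ N ≤ X ^ N := pow_le_pow_left₀ (by positivity) hfl N
      have h2 : X ^ N = ((2 : ℝ) ^ j) ^ M := by
        rw [hXd, ← Real.rpow_natCast, ← Real.rpow_mul (by positivity),
          div_mul_cancel₀ _ hN0.ne', Real.rpow_natCast]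
      have h3 : ((2 : ℝ) ^ j) ^ M < (2 ^ j + 1) ^ M :=
        pow_lt_pow_left₀ (by linarith) (by positivity) (by omega)
      have := h1.trans_lt (h2 ▸ h3)
      exact_mod_cast this
    obtain ⟨v, hv0, hvT, hvd⟩ := exists_dualDist_le A (2 ^ j) ⌊X⌋₊ hL hLT
    obtain ⟨i, hi1, hi2⟩ := exists_nat_pow_near (one_le_norm_of_ne_zero hv0) one_lt_two
    refine ⟨i, ?_, (hmin i v hi1 hi2).trans (hvd.trans ?_)⟩
    · push_cast at hvT
      exact (pow_le_pow_iff_right₀ one_lt_two).1 (hi1.trans hvT)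
    · rw [Real.rpow_neg (by positivity), ← hXd, div_le_iff₀ (by positivity)]
      have := Nat.lt_floor_add_one X
      have h1 : (1 : ℝ) ≤ ⌊X⌋₊ := by exact_mod_cast hL
      rw [mul_assoc, mul_comm, mul_assoc, ← div_eq_inv_mul, le_div_iff₀ (by positivity)] at *
      linarith
  have hexp : (0 : ℝ) < (N : ℝ) / M := by positivity
  -- With `X = (4 * N * Q / c) ^ (N / M)` and `2 ^ j ≤ X < 2 ^ (j + 1)`, some `y i`, `i ≤ j + 1`,
  -- makes the first term of `le_dualDist_add` at most `c / 2`, while `‖y i‖ ≤ 4 * M * X`. Hence `w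
  -- ≥ c / (8 * M * X)`; the `16` makes the inequality strict.
  refine ⟨c / (16 * M) * (4 * N / c) ^ (-((N : ℝ) / M)), by positivity, fun q hq p => ?_⟩
  set Q := ‖intVec q‖ with hQ
  have hQ1 : 1 ≤ Q := (one_le_norm_of_ne_zero hq).trans (norm_le_norm_intVec q)
  set w := ‖(matVec A (intVec q) - x) - intVec p‖ with hw
  have hu : 1 ≤ 4 * N / c * Q := by
    rw [div_mul_eq_mul_div, le_div_iff₀ hc]
    have : (1 : ℝ) ≤ N := by exact_mod_cast hN
    nlinarith
  set X := (4 * N / c * Q) ^ ((N : ℝ) / M) with hX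
  have hX1 : 1 ≤ X := Real.one_le_rpow hu hexp.le
  obtain ⟨j, hj1, hj2⟩ := exists_nat_pow_near hX1 one_lt_two
  obtain ⟨i, hij, hi⟩ := hdir (j + 1)
  have hsmall : ((2 : ℝ) ^ (j + 1)) ^ (-((M : ℝ) / N)) ≤ (4 * N / c * Q)⁻¹ := by
    have := Real.rpow_le_rpow_of_nonpos (z := -((M : ℝ) / N)) (by positivity) hj2.le
      (by rw [neg_nonpos]; positivity)
    refine this.trans (le_of_eq ?_)
    rw [hX, ← Real.rpow_mul (by positivity), ← Real.rpow_neg_one]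
    congr 1
    field_simp
  have hmain := le_dualDist_add A x (y i) q p (hcx i)
  have h1 : N * dualDist A (y i) * Q ≤ c / 2 := by
    calc N * dualDist A (y i) * Q ≤ N * (2 * (4 * N / c * Q)⁻¹) * Q := by
          gcongr
          exact hi.trans (by gcongr)
      _ = c / 2 := by field_simp; ring
  have h2 : ‖intVec (y i)‖ ≤ 4 * M * X := by
    refine (hyub i).trans ?_
    have : (2 : ℝ) ^ i ≤ 2 ^ (j + 1) := pow_le_pow_right₀ (by norm_num) hij
    rw [pow_succ] at this
    nlinarith
  have h3 : c / 2 ≤ 4 * M * X * w := by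
    have : ‖intVec (y i)‖ * w ≤ 4 * M * X * w := by gcongr
    linarith
  have hXinv : (4 * N / c) ^ (-((N : ℝ) / M)) * Q ^ (-((N : ℝ) / M)) = X⁻¹ := by
    rw [← Real.mul_rpow (by positivity) (by positivity), Real.rpow_neg (by positivity)]
  change _ * Q ^ (-((N : ℝ) / M)) < w
  rw [mul_assoc, hXinv, ← div_eq_mul_inv, div_lt_iff₀ (by positivity), div_lt_iff₀ (by positivity)]
  nlinarith

end Dual

/-! ### Escaping from hyperplanes on a diffuse set. -/

section Hyperplanes

variable {M : ℕ}

local notation "𝔼" => EuclideanSpace ℝ (Fin M)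

/-- A hyperplane diffuse set has, in each of its small balls, points far from any given
hyperplane `⟪n, z⟫ = t`. -/
theorem IsHyperplaneDiffuse.exists_far_point (hM : 1 ≤ M) {K : Set 𝔼}
    (hK : IsHyperplaneDiffuse K) :
    ∃ β ρK : ℝ, 0 < β ∧ β < 1 ∧ 0 < ρK ∧ ∀ ρ, 0 < ρ → ρ ≤ ρK → ∀ x ∈ K, ∀ (n : 𝔼) (t : ℝ),
      n ≠ 0 → ∃ x' ∈ K, dist x' x ≤ ρ ∧ β * ρ * ‖n‖ < |inner ℝ n x' - t| := by
  obtain ⟨-, β, hβ0, hβ1, ρK, hρK, h⟩ := hK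
  refine ⟨β, ρK, hβ0, hβ1, hρK, fun ρ hρ hρ' x hx n t hn => ?_⟩
  have hn' : 0 < ‖n‖ := norm_pos_iff.2 hn
  let L : AffineSubspace ℝ 𝔼 := AffineSubspace.mk' ((t / ‖n‖ ^ 2) • n) (innerₛₗ ℝ n).ker
  have hmem : ∀ z : 𝔼, z ∈ L ↔ inner ℝ n z = t := fun z => by
    rw [AffineSubspace.mem_mk', LinearMap.mem_ker, innerₛₗ_apply_apply, vsub_eq_sub, inner_sub_right,
      inner_smul_right, real_inner_self_eq_norm_sq, div_mul_cancel₀ _ (by positivity), sub_eq_zero]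
  have hdim : Module.finrank ℝ L.direction = M - 1 := by
    rw [AffineSubspace.direction_mk']
    have h1 := LinearMap.finrank_range_add_finrank_ker (innerₛₗ ℝ n)
    have h2 : (innerₛₗ ℝ n).range = ⊤ := by
      apply LinearMap.range_eq_top.2
      apply LinearMap.surjective
      intro h0
      have := congrArg (fun φ => φ n) h0
      simp [hn] at this
    rw [h2, finrank_top, Module.finrank_self, finrank_euclideanSpace_fin] at h1
    omega
  obtain ⟨x', hx'K, hx'b, hx'L⟩ := h ρ hρ hρ' x hx L ⟨_, AffineSubspace.self_mem_mk' _ _⟩ hdim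
  refine ⟨x', hx'K, hx'b, ?_⟩
  by_contra! hle
  apply hx'L
  -- The witness is the orthogonal projection of `x'` to the hyperplane.
  refine mem_cthickening_of_dist_le x' (x' - ((inner ℝ n x' - t) / ‖n‖ ^ 2) • n) _ _ ?_ ?_
  · rw [SetLike.mem_coe, hmem, inner_sub_right, inner_smul_right, real_inner_self_eq_norm_sq,
      div_mul_cancel₀ _ (by positivity)]
    ring
  · rw [dist_eq_norm, sub_sub_cancel, norm_smul, Real.norm_eq_abs, abs_div, abs_of_pos
      (show 0 < ‖n‖ ^ 2 by positivity), div_mul_eq_mul_div, div_le_iff₀ (by positivity)]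
    nlinarith

/-- A ball centred at a set `K` contains a bounded number of points of `K` forming a net at a
comparable scale. -/
theorem exists_finset_net (η : ℝ) (hη : 0 < η) :
    ∃ m : ℕ, ∀ (K : Set 𝔼) (x : 𝔼) (r : ℝ), 0 < r →
      ∃ F : Finset 𝔼, F.card ≤ m ∧ (∀ y ∈ F, y ∈ K ∧ dist y x ≤ r) ∧
        ∀ x' ∈ K, dist x' x ≤ r → ∃ y ∈ F, dist x' y ≤ η * r := by
  classical
  -- Cover the unit ball once and rescale, so that `m` does not depend on `K`, `x` or `r`; each cell
  -- that meets `K` contributes one point.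
  obtain ⟨T, -, hTf, hT⟩ :=
    (isCompact_closedBall (0 : 𝔼) 1).finite_cover_balls (half_pos hη)
  lift T to Finset 𝔼 using hTf
  refine ⟨T.card, fun K x r hr => ?_⟩
  let P : 𝔼 → 𝔼 → Prop := fun c y => y ∈ K ∧ dist y x ≤ r ∧ dist (r⁻¹ • (y - x)) c < η / 2
  let g : 𝔼 → 𝔼 := fun c => if h : ∃ y, P c y then h.choose else 0
  have hg : ∀ c, (∃ y, P c y) → P c (g c) := fun c h => by
    simp only [g, dif_pos h]; exact h.choose_spec
  refine ⟨(T.filter fun c => ∃ y, P c y).image g,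
    Finset.card_image_le.trans (Finset.card_filter_le _ _), ?_, ?_⟩
  · intro y hy
    obtain ⟨c, hc, rfl⟩ := Finset.mem_image.1 hy
    have := hg c (Finset.mem_filter.1 hc).2
    exact ⟨this.1, this.2.1⟩
  · intro x' hx' hd
    have h1 : r⁻¹ • (x' - x) ∈ closedBall (0 : 𝔼) 1 := by
      rw [mem_closedBall_zero_iff, norm_smul, norm_inv, Real.norm_of_nonneg hr.le, ← dist_eq_norm,
        inv_mul_le_iff₀ hr, mul_one]
      exact hd
    obtain ⟨c, hc, hcx⟩ := mem_iUnion₂.1 (hT h1)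
    have hex : ∃ y, P c y := ⟨x', hx', hd, hcx⟩
    refine ⟨g c, Finset.mem_image_of_mem _ (Finset.mem_filter.2 ⟨hc, hex⟩), ?_⟩
    have h2 := (dist_triangle_right (r⁻¹ • (x' - x)) (r⁻¹ • (g c - x)) c).trans
      (add_le_add (mem_ball.1 hcx).le (hg c hex).2.2.le)
    rw [dist_eq_norm, ← smul_sub, sub_sub_sub_cancel_right, norm_smul, norm_inv,
      Real.norm_of_nonneg hr.le, ← dist_eq_norm, inv_mul_le_iff₀ hr] at h2
    linarith

/-- Alice's basic move: given finitely many weighted hyperplanes, she can get away from a fixed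
proportion of them. -/
theorem IsHyperplaneDiffuse.exists_avoiding_ball (hM : 1 ≤ M) {K : Set 𝔼}
    (hK : IsHyperplaneDiffuse K) :
    ∃ α θ ρ₁ : ℝ, 0 < α ∧ α < 1 ∧ 0 ≤ θ ∧ θ < 1 ∧ 0 < ρ₁ ∧
      ∀ x ∈ K, ∀ r, 0 < r → r ≤ ρ₁ → ∀ (J : Finset ℕ) (w : ℕ → ℝ) (n : ℕ → 𝔼) (t : ℕ → ℝ),
        (∀ j ∈ J, 0 ≤ w j) → (∀ j ∈ J, n j ≠ 0) →
        ∃ x' ∈ K, closedBall x' (α * r) ⊆ closedBall x r ∧ ∀ J' ⊆ J,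
          (∀ j ∈ J', ∃ z ∈ closedBall x' (α * r), |inner ℝ (n j) z - t j| ≤ α * r * ‖n j‖) →
          ∑ j ∈ J', w j ≤ θ * ∑ j ∈ J, w j := by
  classical
  obtain ⟨β, ρK, hβ0, hβ1, hρK, hfar⟩ := hK.exists_far_point hM
  obtain ⟨m, hm⟩ := exists_finset_net (M := M) (β / 2) (by positivity)
  -- A point at distance over `β * r / 2` from the hyperplane has a net point within `β * r / 4`; a
  -- ball of radius `β * r / 8` about that point still keeps distance over `β * r / 8`.
  refine ⟨β / 8, 1 - 1 / (m + 1), ρK, by positivity, by linarith, ?_, ?_, hρK, ?_⟩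
  · rw [sub_nonneg, div_le_one (by positivity)]; linarith [Nat.cast_nonneg (α := ℝ) m]
  · have : (0 : ℝ) < 1 / (m + 1) := by positivity
    linarith
  intro x hx r hr hrρ J w n t hw hn
  obtain ⟨F, hFm, hFK, hFnet⟩ := hm K x (r / 2) (by positivity)
  let bad : 𝔼 → ℕ → Prop := fun y j =>
    ∃ z ∈ closedBall y (β / 8 * r), |inner ℝ (n j) z - t j| ≤ β / 8 * r * ‖n j‖
  have hgood : ∀ j ∈ J, ∃ y ∈ F, ¬ bad y j := by
    intro j hj
    obtain ⟨x', hx'K, hx'd, hx'f⟩ := hfar (r / 2) (by positivity) (by linarith) x hx (n j) (t j)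
      (hn j hj)
    obtain ⟨y, hyF, hy⟩ := hFnet x' hx'K hx'd
    refine ⟨y, hyF, ?_⟩
    rintro ⟨z, hz, hzb⟩
    have h1 : |inner ℝ (n j) (x' - z)| ≤ ‖n j‖ * (β / 2 * (r / 2) + β / 8 * r) := by
      refine (abs_real_inner_le_norm _ _).trans ?_
      gcongr
      rw [← dist_eq_norm]
      refine (dist_triangle x' y z).trans (add_le_add hy ?_)
      rw [dist_comm]; exact hz
    have h2 : inner ℝ (n j) x' - t j = inner ℝ (n j) (x' - z) + (inner ℝ (n j) z - t j) := by
      rw [inner_sub_right]; ring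
    rw [h2] at hx'f
    have h3 := abs_add_le (inner ℝ (n j) (x' - z)) (inner ℝ (n j) z - t j)
    nlinarith
  have hFne : F.Nonempty := by
    obtain ⟨y, hy, -⟩ := hFnet x hx (by rw [dist_self]; positivity)
    exact ⟨y, hy⟩
  set W := ∑ j ∈ J, w j with hW
  have hW0 : 0 ≤ W := Finset.sum_nonneg hw
  -- Averaging: every hyperplane is avoided from at least one net point, so the avoided weights,
  -- summed over `F`, total at least `W`.
  obtain ⟨y, hyF, hy⟩ : ∃ y ∈ F, W / F.card ≤ ∑ j ∈ J with ¬ bad y j, w j := by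
    apply Finset.exists_le_of_sum_le hFne
    rw [Finset.sum_const, nsmul_eq_mul, mul_div_cancel₀ _ (by
      exact_mod_cast hFne.card_pos.ne')]
    simp only [Finset.sum_filter]
    rw [Finset.sum_comm]
    refine Finset.sum_le_sum fun j hj => ?_
    obtain ⟨y, hyF, hy⟩ := hgood j hj
    refine le_trans (le_of_eq ?_) (Finset.single_le_sum (fun y' _ => ?_) hyF)
    · simp [hy]
    · split_ifs; exacts [le_rfl, hw j hj]
  refine ⟨y, (hFK y hyF).1, ?_, ?_⟩
  · apply closedBall_subset_closedBall'
    have := (hFK y hyF).2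
    nlinarith
  · intro J' hJ' hbad
    have h1 : ∑ j ∈ J', w j ≤ ∑ j ∈ J with bad y j, w j := by
      refine Finset.sum_le_sum_of_subset_of_nonneg ?_ fun j hj _ => hw j (Finset.mem_filter.1 hj).1
      exact fun j hj => Finset.mem_filter.2 ⟨hJ' hj, hbad j hj⟩
    have h2 := Finset.sum_filter_add_sum_filter_not J (bad y) w
    have h3 : W / (m + 1) ≤ W / F.card := by
      have : (0 : ℝ) < F.card := by exact_mod_cast hFne.card_pos
      gcongr
      have : (F.card : ℝ) ≤ m := by exact_mod_cast hFm
      linarith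
    have h4 : (1 - 1 / ((m : ℝ) + 1)) * W = W - W / (m + 1) := by ring
    rw [h4]
    linarith

end Hyperplanes

/-! ### Straightening the preimages of hyperplanes. -/

section Linearization

variable {M : ℕ}

local notation "𝔼" => EuclideanSpace ℝ (Fin M)

/-- The adjoint of the derivative of the inverse map inverts the adjoint of `fderiv ℝ f x` (on both
sides, by finite dimension), and its norm is bounded on the compact `P`. This keeps the normal `n`
of the strip from being much shorter than `y`. -/
theorem IsC1DiffeoOn.exists_inverse_bound {U : Set 𝔼} (hU : IsOpen U) {f : 𝔼 → 𝔼}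
    (hf : IsC1DiffeoOn U f) {P : Set 𝔼} (hP : IsCompact P) (hPU : P ⊆ U) :
    ∃ C : ℝ, 0 < C ∧ ∀ x ∈ P, ∀ y : 𝔼, ‖y‖ ≤ C * ‖(fderiv ℝ f x).adjoint y‖ := by
  obtain ⟨hfc, hV, g, hg, hgf⟩ := hf
  have hcont : ContinuousOn (fun x => fderiv ℝ g (f x)) P :=
    (hg.continuousOn_fderiv_of_isOpen hV le_rfl).comp (hfc.continuousOn.mono hPU)
      fun x hx => mem_image_of_mem f (hPU hx)
  obtain ⟨C, hC⟩ := hP.exists_bound_of_continuousOn hcont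
  refine ⟨max C 1, by positivity, fun x hx y => ?_⟩
  have hxU := hPU hx
  have hfx : DifferentiableAt ℝ f x :=
    (hfc.contDiffAt (hU.mem_nhds hxU)).differentiableAt one_ne_zero
  have hgx : DifferentiableAt ℝ g (f x) :=
    (hg.contDiffAt (hV.mem_nhds (mem_image_of_mem f hxU))).differentiableAt one_ne_zero
  have hcomp : (fderiv ℝ g (f x)).comp (fderiv ℝ f x) = ContinuousLinearMap.id ℝ 𝔼 := by
    rw [← fderiv_comp x hgx hfx, ← fderiv_id (𝕜 := ℝ) (x := x)]
    apply Filter.EventuallyEq.fderiv_eq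
    filter_upwards [hU.mem_nhds hxU] with z hz using hgf z hz
  have hadj := congrArg ContinuousLinearMap.adjoint hcomp
  rw [ContinuousLinearMap.adjoint_comp] at hadj
  have hid : ContinuousLinearMap.adjoint (ContinuousLinearMap.id ℝ 𝔼)
      = ContinuousLinearMap.id ℝ 𝔼 := ContinuousLinearMap.adjoint_id
  rw [hid] at hadj
  have hcomm : ((fderiv ℝ g (f x)).adjoint).comp ((fderiv ℝ f x).adjoint)
      = ContinuousLinearMap.id ℝ 𝔼 := by
    have h1 : ((fderiv ℝ f x).adjoint : 𝔼 →ₗ[ℝ] 𝔼) ∘ₗ ((fderiv ℝ g (f x)).adjoint : 𝔼 →ₗ[ℝ] 𝔼)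
        = LinearMap.id := by
      ext1 v; exact congrArg (fun φ => φ v) hadj
    ext1 v
    exact congrArg (fun φ => φ v) ((LinearMap.comp_eq_id_comm ℝ 𝔼).1 h1)
  have h2 : y = (fderiv ℝ g (f x)).adjoint ((fderiv ℝ f x).adjoint y) :=
    (congrArg (fun φ => φ y) hcomm).symm
  calc ‖y‖ = ‖(fderiv ℝ g (f x)).adjoint ((fderiv ℝ f x).adjoint y)‖ := by rw [← h2]
    _ ≤ ‖(fderiv ℝ g (f x)).adjoint‖ * ‖(fderiv ℝ f x).adjoint y‖ :=
        ContinuousLinearMap.le_opNorm _ _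
    _ ≤ max C 1 * ‖(fderiv ℝ f x).adjoint y‖ := by
        gcongr
        rw [LinearIsometryEquiv.norm_map]
        exact (hC x hx).trans (le_max_left _ _)

/-- Near a small ball the preimage under a `C¹` diffeomorphism of the neighbourhood of a family of
parallel hyperplanes lies in the neighbourhood of a single hyperplane. -/
theorem IsC1DiffeoOn.exists_strip {U : Set 𝔼} (hU : IsOpen U) {f : 𝔼 → 𝔼}
    (hf : IsC1DiffeoOn U f) {p : 𝔼} {R : ℝ} (hPU : closedBall p R ⊆ U) {α : ℝ} (hα : 0 < α) :
    ∃ κ c₁ r₀ : ℝ, 0 < κ ∧ 0 < c₁ ∧ 0 < r₀ ∧ ∀ x ∈ closedBall p R, ∀ r, 0 < r → r ≤ r₀ →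
      ∀ (y : 𝔼) (c : ℝ), y ≠ 0 → ‖y‖ * r ≤ κ → c ≤ c₁ * (‖y‖ * r) →
        ∃ (n : 𝔼) (t : ℝ), n ≠ 0 ∧ ∀ z ∈ closedBall p R, dist z x ≤ r →
          (∃ m : ℤ, |inner ℝ y (f z) - m| < c) → |inner ℝ n z - t| ≤ α * r * ‖n‖ := by
  have hP := isCompact_closedBall p R
  obtain ⟨C, hC0, hC⟩ := hf.exists_inverse_bound hU hP hPU
  have hfc := hf.1
  have hcont : ContinuousOn (fderiv ℝ f) (closedBall p R) :=
    (hfc.continuousOn_fderiv_of_isOpen hU le_rfl).mono hPU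
  obtain ⟨L, hL⟩ := hP.exists_bound_of_continuousOn hcont
  -- The linearization error and the thickness `c` each contribute at most `ε * ‖y‖ * r`, and `2 * ε
  -- * ‖y‖ = α * ‖y‖ / C ≤ α * ‖n‖`.
  set ε := α / (2 * C) with hε
  have hε0 : 0 < ε := by positivity
  obtain ⟨r₀, hr₀, hunif⟩ :=
    Metric.uniformContinuousOn_iff.1 (hP.uniformContinuousOn_of_continuous hcont) ε hε0
  have hdiff : ∀ z ∈ closedBall p R, DifferentiableAt ℝ f z := fun z hz =>
    (hfc.contDiffAt (hU.mem_nhds (hPU hz))).differentiableAt one_ne_zero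
  set L' := max L 1 + ε with hL'
  have hL'0 : 0 < L' := by positivity
  -- This `κ` makes `⟪y, f ·⟫` vary by at most `1 / 8` from its value at `x`; as also `c ≤ 1 / 8`,
  -- only the integer nearest to `⟪y, f x⟫` can occur.
  refine ⟨1 / (8 * L'), min ε L', r₀ / 2, by positivity, by positivity, by positivity, ?_⟩
  intro x hx r hr hrr y c hy hκ hc
  set n := (fderiv ℝ f x).adjoint y with hn
  have hynorm : 0 < ‖y‖ := norm_pos_iff.2 hy
  have hn0 : 0 < ‖n‖ := by
    by_contra! h
    have := hC x hx y
    nlinarith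
  have happ : ∀ z ∈ closedBall p R, dist z x ≤ r →
      ‖f z - f x - fderiv ℝ f x (z - x)‖ ≤ ε * r := by
    intro z hz hzx
    have hconv : Convex ℝ (closedBall p R ∩ closedBall x r) :=
      (convex_closedBall _ _).inter (convex_closedBall _ _)
    refine (hconv.norm_image_sub_le_of_norm_fderiv_le' (𝕜 := ℝ) (f := f) (C := ε)
      (φ := fderiv ℝ f x) (fun u hu => hdiff u hu.1) (fun u hu => ?_)
      ⟨hx, mem_closedBall_self hr.le⟩ ⟨hz, hzx⟩).trans ?_
    · rw [← dist_eq_norm]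
      refine (hunif u hu.1 x hx ?_).le
      have : dist u x ≤ r := hu.2
      linarith
    · rw [← dist_eq_norm]; gcongr
  have hinner : ∀ z, inner ℝ n (z - x) = inner ℝ y (fderiv ℝ f x (z - x)) := fun z => by
    rw [hn, ContinuousLinearMap.adjoint_inner_left]
  have hκ' : L' * (‖y‖ * r) ≤ 1 / 8 := by
    rw [le_div_iff₀ (by positivity)] at hκ
    linarith
  have hc8 : c ≤ 1 / 8 := by
    refine le_trans (hc.trans ?_) hκ'
    gcongr
    exact min_le_right _ _
  have hcε : c ≤ ε * (‖y‖ * r) := hc.trans (by gcongr; exact min_le_left _ _)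
  have hclose : ∀ z ∈ closedBall p R, dist z x ≤ r →
      |inner ℝ y (f z) - inner ℝ y (f x)| ≤ 1 / 8 := by
    intro z hz hzx
    refine le_trans ?_ hκ'
    rw [← inner_sub_right]
    refine (abs_real_inner_le_norm _ _).trans ?_
    have h1 : ‖f z - f x‖ ≤ L' * r := by
      have h2 : f z - f x = (f z - f x - fderiv ℝ f x (z - x)) + fderiv ℝ f x (z - x) := by abel
      have h3 : ‖fderiv ℝ f x (z - x)‖ ≤ max L 1 * r := by
        refine (ContinuousLinearMap.le_opNorm _ _).trans ?_
        rw [← dist_eq_norm]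
        gcongr
        exact (hL x hx).trans (le_max_left _ _)
      rw [h2]
      refine (norm_add_le _ _).trans ?_
      have := happ z hz hzx
      rw [hL']; linarith
    calc ‖y‖ * ‖f z - f x‖ ≤ ‖y‖ * (L' * r) := by gcongr
      _ = L' * (‖y‖ * r) := by ring
  set m₀ := round (inner ℝ y (f x) : ℝ) with hm₀
  refine ⟨n, m₀ - inner ℝ y (f x) + inner ℝ n x, norm_pos_iff.1 hn0, ?_⟩
  rintro z hz hzx ⟨m, hm⟩
  have hb := hclose z hz hzx
  have hmm : m = m₀ := by
    have h1 : |(inner ℝ y (f x) : ℝ) - m| < 1 / 4 := by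
      have := abs_sub_abs_le_abs_sub (inner ℝ y (f x) - (m : ℝ)) (inner ℝ y (f z) - (m : ℝ))
      rw [sub_sub_sub_cancel_right, abs_sub_comm (inner ℝ y (f x) : ℝ) (inner ℝ y (f z))] at this
      linarith
    have h2 : |(inner ℝ y (f x) : ℝ) - m₀| ≤ |(inner ℝ y (f x) : ℝ) - m| := round_le _ _
    have h3 : |((m : ℝ) - m₀)| < 1 := by
      have := abs_sub_le (m : ℝ) (inner ℝ y (f x)) m₀
      rw [abs_sub_comm (m : ℝ) (inner ℝ y (f x))] at this
      linarith
    have h4 : |m - m₀| < 1 := by exact_mod_cast h3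
    have := Int.abs_lt_one_iff.1 h4
    omega
  subst hmm
  have h1 : inner ℝ n z - (m₀ - inner ℝ y (f x) + inner ℝ n x)
      = (inner ℝ y (f z) - m₀) - inner ℝ y (f z - f x - fderiv ℝ f x (z - x)) := by
    rw [inner_sub_right y (f z - f x), ← hinner, inner_sub_right, inner_sub_right]
    ring
  rw [h1]
  have h2 : |inner ℝ y (f z - f x - fderiv ℝ f x (z - x))| ≤ ‖y‖ * (ε * r) :=
    (abs_real_inner_le_norm _ _).trans (by gcongr; exact happ z hz hzx)
  calc |(inner ℝ y (f z) - (m₀ : ℝ)) - inner ℝ y (f z - f x - fderiv ℝ f x (z - x))|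
      ≤ |inner ℝ y (f z) - (m₀ : ℝ)| + |inner ℝ y (f z - f x - fderiv ℝ f x (z - x))| := abs_sub _ _
    _ ≤ ε * (‖y‖ * r) + ‖y‖ * (ε * r) := add_le_add (hm.le.trans hcε) h2
    _ = α * r * (‖y‖ / C) := by rw [hε]; field_simp; ring
    _ ≤ α * r * ‖n‖ := by
        gcongr
        rw [div_le_iff₀ hC0, mul_comm]
        exact hC x hx y

end Linearization

/-- Alice can steer every play of the game with fixed ratio `γ` between consecutive radii, starting
inside `P` with radius `R₀`, into `T`, by maintaining an invariant `I` of the current ball: her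
moves depend only on the current position. -/
def IsPositionallyWinningOn {d : ℕ} (K : Set (EuclideanSpace ℝ (Fin d))) (α : ℝ)
    (P T : Set (EuclideanSpace ℝ (Fin d))) : Prop :=
  ∀ γ R₀ : ℝ, 0 < γ → γ < 1 → 0 < R₀ → ∃ I : EuclideanSpace ℝ (Fin d) → ℝ → Prop,
    (∀ x, I x R₀) ∧
    (∀ x ∈ K, ∀ r, 0 < r → closedBall x r ⊆ P → I x r →
      ∃ x' ∈ K, closedBall x' (α * r) ⊆ closedBall x r ∧
        ∀ x'', closedBall x'' (γ * r) ⊆ closedBall x' (α * r) → I x'' (γ * r)) ∧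
    ∀ z ∈ P, (∀ ε > 0, ∃ x r, 0 < r ∧ r < ε ∧ z ∈ closedBall x r ∧ I x r) → z ∈ T

/-! ### The potential strategy for one diffeomorphism. -/

section Potential

theorem sum_pow_le_inv {q : ℝ} (hq0 : 0 ≤ q) (hq1 : q < 1) (J : Finset ℕ) :
    ∑ j ∈ J, q ^ j ≤ (1 - q)⁻¹ := by
  rw [← tsum_geometric_of_lt_one hq0 hq1]
  exact (summable_geometric_of_lt_one hq0 hq1).sum_le_tsum J fun _ _ => by positivity

theorem two_pow_rpow_neg (s : ℝ) (j : ℕ) : ((2 : ℝ) ^ j) ^ (-s) = ((2 : ℝ) ^ (-s)) ^ j := by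
  rw [← Real.rpow_natCast, ← Real.rpow_natCast, ← Real.rpow_mul (by norm_num),
    ← Real.rpow_mul (by norm_num), mul_comm]

theorem sum_two_pow_rpow_neg_le {s : ℝ} (hs : 0 < s) (J : Finset ℕ) :
    ∑ j ∈ J, ((2 : ℝ) ^ j) ^ (-s) ≤ (1 - (2 : ℝ) ^ (-s))⁻¹ := by
  simp only [two_pow_rpow_neg]
  exact sum_pow_le_inv (by positivity) (Real.rpow_lt_one_of_one_lt_of_neg one_lt_two (by linarith)) J

theorem sum_two_pow_rpow_neg_le_of_lt {s : ℝ} (hs : 0 < s) (J : Finset ℕ) {X : ℝ} (hX : 0 < X)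
    (hJ : ∀ j ∈ J, X < 2 ^ j) :
    ∑ j ∈ J, ((2 : ℝ) ^ j) ^ (-s) ≤ X ^ (-s) * (1 - (2 : ℝ) ^ (-s))⁻¹ := by
  have hq1 : (2 : ℝ) ^ (-s) < 1 := Real.rpow_lt_one_of_one_lt_of_neg one_lt_two (by linarith)
  have hpos : 0 < 1 - (2 : ℝ) ^ (-s) := by linarith
  rcases J.eq_empty_or_nonempty with rfl | hne
  · simp only [Finset.sum_empty]; positivity
  set j₀ := J.min' hne
  have hmin : ∀ j ∈ J, j₀ ≤ j := fun j hj => J.min'_le j hj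
  calc ∑ j ∈ J, ((2 : ℝ) ^ j) ^ (-s)
      = ((2 : ℝ) ^ j₀) ^ (-s) * ∑ j ∈ J, ((2 : ℝ) ^ (-s)) ^ (j - j₀) := by
        rw [Finset.mul_sum]
        refine Finset.sum_congr rfl fun j hj => ?_
        rw [two_pow_rpow_neg, two_pow_rpow_neg, ← pow_add, Nat.add_sub_cancel' (hmin j hj)]
    _ = ((2 : ℝ) ^ j₀) ^ (-s) * ∑ i ∈ J.image (· - j₀), ((2 : ℝ) ^ (-s)) ^ i := by
        rw [Finset.sum_image]
        intro a ha b hb hab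
        have h1 := hmin a ha
        have h2 := hmin b hb
        simp only at hab
        omega
    _ ≤ X ^ (-s) * (1 - (2 : ℝ) ^ (-s))⁻¹ := by
        refine mul_le_mul ?_ (sum_pow_le_inv (by positivity) hq1 _) (by positivity) (by positivity)
        exact Real.rpow_le_rpow_of_nonpos hX (hJ _ (J.min'_mem hne)).le (by linarith)

/-- Applied with `a = 2 ^ j` to a single term of the potential: a strip that still meets the ball
has `2 ^ j * r` bounded below. -/
theorem rpow_le_mul_of_rpow_neg_le {a r s Q : ℝ} (ha : 0 < a) (hr : 0 < r) (hs : 0 < s)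
    (h : a ^ (-s) ≤ Q * r ^ s) : Q ^ (-(1 / s)) ≤ a * r := by
  have h1 : (a * r) ^ (-s) ≤ Q := by
    rw [Real.mul_rpow ha.le hr.le, Real.rpow_neg hr.le, ← div_eq_mul_inv, div_le_iff₀ (by positivity)]
    exact h
  calc Q ^ (-(1 / s)) ≤ ((a * r) ^ (-s)) ^ (-(1 / s)) :=
        Real.rpow_le_rpow_of_nonpos (by positivity) h1 (by rw [neg_nonpos]; positivity)
    _ = a * r := by
        rw [← Real.rpow_mul (by positivity)]
        have : -s * -(1 / s) = 1 := by field_simp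
        rw [this, Real.rpow_one]

variable {M N : ℕ}

/-- The preimages of `Bad_A(M,N)` under all `C¹` diffeomorphisms are positionally winning, with a
common `α`. -/
theorem IsHyperplaneDiffuse.exists_isPositionallyWinningOn (hM : 1 ≤ M) (hN : 1 ≤ N)
    (A : Matrix (Fin M) (Fin N) ℝ) {K : Set (EuclideanSpace ℝ (Fin M))}
    (hK : IsHyperplaneDiffuse K) :
    ∃ α : ℝ, 0 < α ∧ α < 1 ∧ ∀ U : Set (EuclideanSpace ℝ (Fin M)), IsOpen U →
      ∀ f, IsC1DiffeoOn U f → ∀ p R, closedBall p R ⊆ U →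
        IsPositionallyWinningOn K α (closedBall p R) {z | f z ∈ badSlice A} := by
  classical
  obtain ⟨α, θ, ρ₁, hα0, hα1, hθ0, hθ1, hρ₁, havoid⟩ := hK.exists_avoiding_ball hM
  obtain ⟨y, hy, hyA⟩ := exists_dual_sequence hM hN A
  refine ⟨α, hα0, hα1, fun U hU f hf p R hPU γ R₀ hγ0 hγ1 hR₀ => ?_⟩
  obtain ⟨κ, c₁, r₀, hκ, hc₁, hr₀, hstrip⟩ := hf.exists_strip hU hPU hα0
  have hM0 : (0 : ℝ) < M := by exact_mod_cast hM
  have hθ' : 0 < (1 - θ) / 2 := by linarith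
  -- Chosen so that `γ ^ s = θ + (1 - θ) / 2`: surviving old strips use the share `θ` of the budget,
  -- new strips the share `(1 - θ) / 2`.
  set s := Real.logb γ ((1 + θ) / 2) with hsdef
  have hs : 0 < s := Real.logb_pos_of_base_lt_one hγ0 hγ1 (by linarith) (by linarith)
  have hγs : γ ^ s = (1 + θ) / 2 := Real.rpow_logb hγ0 hγ1.ne (by linarith)
  set W := (1 - (2 : ℝ) ^ (-s))⁻¹ with hW
  have hW0 : 0 < W := by
    have : (2 : ℝ) ^ (-s) < 1 := Real.rpow_lt_one_of_one_lt_of_neg one_lt_two (by linarith)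
    exact inv_pos.2 (by linarith)
  set κ' := κ / (2 * M) with hκ'
  have hκ'0 : 0 < κ' := by positivity
  set r₁ := min r₀ ρ₁ with hr₁
  have hr₁0 : 0 < r₁ := by positivity
  -- The three lower bounds serve the initial ball, the balls of radius above `r₁`, and the newly
  -- active strips, respectively.
  obtain ⟨Q, hQ0, hQ1, hQ2, hQ3⟩ : ∃ Q : ℝ, 0 < Q ∧ W * R₀ ^ (-s) ≤ Q ∧
      W * (γ * r₁) ^ (-s) ≤ Q ∧ κ' ^ (-s) * W / ((1 - θ) / 2) ≤ Q := by
    have h1 : 0 < W * R₀ ^ (-s) := by positivity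
    have h2 : 0 < W * (γ * r₁) ^ (-s) := by positivity
    have h3 : 0 < κ' ^ (-s) * W / ((1 - θ) / 2) := by positivity
    exact ⟨W * R₀ ^ (-s) + W * (γ * r₁) ^ (-s) + κ' ^ (-s) * W / ((1 - θ) / 2),
      by positivity, by linarith, by linarith, by linarith⟩
  have htriv : ∀ ρ₀ ρ : ℝ, 0 < ρ₀ → ρ₀ ≤ ρ → W * ρ₀ ^ (-s) ≤ Q → W ≤ Q * ρ ^ s := by
    intro ρ₀ ρ h0 h1 h2
    rw [Real.rpow_neg h0.le, ← div_eq_mul_inv, div_le_iff₀ (by positivity)] at h2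
    refine h2.trans ?_
    gcongr
  -- One width for all `j`: a strip in play has `2 ^ j * r ≥ Q ^ (-(1 / s))`, so `c ≤ c₁ * (‖y j‖ *
  -- r)`, as `IsC1DiffeoOn.exists_strip` demands.
  set c := c₁ * Q ^ (-(1 / s)) with hc
  let bad : ℕ → EuclideanSpace ℝ (Fin M) → Prop := fun j z =>
    ∃ m : ℤ, |inner ℝ (y j) (f z) - m| < c
  refine ⟨fun x r => ∀ J : Finset ℕ, (∀ j ∈ J, 2 ^ j * r ≤ κ' ∧ ∃ z ∈ closedBall x r, bad j z) →
    ∑ j ∈ J, ((2 : ℝ) ^ j) ^ (-s) ≤ Q * r ^ s, ?_, ?_, ?_⟩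
  · exact fun x J _ => (sum_two_pow_rpow_neg_le hs J).trans (htriv R₀ R₀ hR₀ le_rfl hQ1)
  · intro x hx r hr hxr hI
    -- On large balls any legal move will do, since the next budget exceeds the total weight `W` of
    -- all strips.
    rcases lt_or_ge r₁ r with hlt | hle
    · refine ⟨x, hx, closedBall_subset_closedBall (by nlinarith), fun x'' _ J _ => ?_⟩
      exact (sum_two_pow_rpow_neg_le hs J).trans
        (htriv (γ * r₁) (γ * r) (by positivity) (by gcongr) hQ2)
    let J₀ : Finset ℕ := (Finset.range ⌈κ' / r⌉₊).filter fun j =>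
      2 ^ j * r ≤ κ' ∧ ∃ z ∈ closedBall x r, bad j z
    have hJ₀ : ∀ j, j ∈ J₀ ↔ 2 ^ j * r ≤ κ' ∧ ∃ z ∈ closedBall x r, bad j z := by
      intro j
      simp only [J₀, Finset.mem_filter, Finset.mem_range, and_iff_right_iff_imp]
      rintro ⟨hj, -⟩
      rw [Nat.lt_ceil, lt_div_iff₀ hr]
      refine lt_of_lt_of_le ?_ hj
      gcongr
      exact_mod_cast Nat.lt_two_pow_self
    have hstr : ∀ j, ∃ (n : EuclideanSpace ℝ (Fin M)) (t : ℝ), j ∈ J₀ → n ≠ 0 ∧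
        ∀ z ∈ closedBall p R, dist z x ≤ r → bad j z → |inner ℝ n z - t| ≤ α * r * ‖n‖ := by
      intro j
      by_cases hj : j ∈ J₀
      · have hj' := (hJ₀ j).1 hj
        have hyj := hy j
        -- The invariant for a singleton gives the lower bound on `2 ^ j * r`.
        have hw := hI {j} (by simpa using hj')
        rw [Finset.sum_singleton] at hw
        have hlow := rpow_le_mul_of_rpow_neg_le (by positivity) hr hs hw
        have h2j : (0 : ℝ) < 2 ^ j := by positivity
        obtain ⟨n, t, hn, hnt⟩ := hstrip x (hxr (mem_closedBall_self hr.le)) r hr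
          (hle.trans (min_le_left _ _)) (y j) c
          (norm_pos_iff.1 (lt_of_lt_of_le h2j hyj.1)) (by
            calc ‖y j‖ * r ≤ 2 * M * 2 ^ j * r := by gcongr; exact hyj.2
              _ = 2 * M * (2 ^ j * r) := by ring
              _ ≤ 2 * M * κ' := by gcongr; exact hj'.1
              _ = κ := by rw [hκ']; field_simp) (by
            rw [hc]
            gcongr
            refine hlow.trans ?_
            gcongr
            exact hyj.1)
        exact ⟨n, t, fun _ => ⟨hn, hnt⟩⟩
      · exact ⟨0, 0, fun h => absurd h hj⟩
    choose n t hnt using hstr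
    obtain ⟨x', hx'K, hx'b, hx'⟩ := havoid x hx r hr (hle.trans (min_le_right _ _)) J₀
      (fun j => ((2 : ℝ) ^ j) ^ (-s)) n t (fun j _ => by positivity) (fun j hj => (hnt j hj).1)
    refine ⟨x', hx'K, hx'b, fun x'' hx'' J hJ => ?_⟩
    have hold : ∑ j ∈ J with 2 ^ j * r ≤ κ', ((2 : ℝ) ^ j) ^ (-s) ≤ θ * (Q * r ^ s) := by
      refine (hx' _ ?_ ?_).trans ?_
      · intro j hj
        rw [Finset.mem_filter] at hj
        obtain ⟨z, hz, hzb⟩ := (hJ j hj.1).2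
        exact (hJ₀ j).2 ⟨hj.2, z, hx'b (hx'' hz), hzb⟩
      · intro j hj
        rw [Finset.mem_filter] at hj
        obtain ⟨z, hz, hzb⟩ := (hJ j hj.1).2
        have hzx := hx'b (hx'' hz)
        exact ⟨z, hx'' hz, (hnt j ((hJ₀ j).2 ⟨hj.2, z, hzx, hzb⟩)).2 z (hxr hzx) hzx hzb⟩
      · gcongr
        exact hI J₀ fun j hj => (hJ₀ j).1 hj
    -- Newly active strips have `2 ^ j > κ' / r`, so a geometric series bounds their weight.
    have hnew : ∑ j ∈ J with ¬ 2 ^ j * r ≤ κ', ((2 : ℝ) ^ j) ^ (-s)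
        ≤ (1 - θ) / 2 * (Q * r ^ s) := by
      refine (sum_two_pow_rpow_neg_le_of_lt hs _ (X := κ' / r) (by positivity) ?_).trans ?_
      · intro j hj
        rw [Finset.mem_filter, not_le] at hj
        rw [div_lt_iff₀ hr]
        exact hj.2
      · rw [div_le_iff₀ hθ'] at hQ3
        rw [Real.div_rpow hκ'0.le hr.le, Real.rpow_neg hr.le, div_inv_eq_mul]
        calc κ' ^ (-s) * r ^ s * W = κ' ^ (-s) * W * r ^ s := by ring
          _ ≤ Q * ((1 - θ) / 2) * r ^ s := by gcongr
          _ = _ := by ring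
    rw [← Finset.sum_filter_add_sum_filter_not J (fun j => 2 ^ j * r ≤ κ'),
      Real.mul_rpow hγ0.le hr.le, hγs]
    linarith
  · intro z hz hI
    refine hyA (f z) ⟨c, by positivity, fun j m => ?_⟩
    by_contra! hlt
    have h2j : (0 : ℝ) < 2 ^ j := by positivity
    have hQs : 0 < Q ^ (-(1 / s)) := by positivity
    -- At so small a radius the strip `j` is active and meets the ball, yet its weight alone exceeds
    -- the budget.
    obtain ⟨x, r, hr, hrε, hzx, hI⟩ := hI (min κ' (Q ^ (-(1 / s))) / 2 ^ j) (by positivity)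
    rw [lt_div_iff₀ h2j, mul_comm] at hrε
    have hw := hI {j} (by
      simp only [Finset.mem_singleton, forall_eq]
      exact ⟨hrε.le.trans (min_le_left _ _), z, hzx, m, hlt⟩)
    rw [Finset.sum_singleton] at hw
    exact absurd (rpow_le_mul_of_rpow_neg_le h2j hr hs hw)
      (not_le.2 (hrε.trans_le (min_le_right _ _)))

end Potential

/-! ### Interleaving countably many strategies. -/

section Game

variable {d : ℕ} {K : Set (EuclideanSpace ℝ (Fin d))} {α β : ℝ} {b a : ℕ → GameBall d}

theorem bob_radius (n : ℕ) (hb : ∀ m ≤ n, BobLegal K β b a m)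
    (ha : ∀ m, (a m).2 = α * (b m).2) : (b n).2 = (b 0).2 * (α * β) ^ n := by
  induction n with
  | zero => simp
  | succ n ih =>
    have h := hb (n + 1) le_rfl
    simp only [BobLegal] at h
    rw [h.2.1, ha, ih fun m hm => hb m (by omega), pow_succ]
    ring

theorem bob_center_mem (n : ℕ) (hb : BobLegal K β b a n) : (b n).1 ∈ K := by
  cases n with
  | zero => exact hb.1
  | succ n => exact hb.1

theorem bob_antitone (hb : ∀ n, BobLegal K β b a n) (ha : ∀ n, (a n).set ⊆ (b n).set) :
    Antitone fun n => (b n).set :=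
  antitone_nat_of_succ_le fun n => (hb (n + 1)).2.2.trans (ha n)

/-- A closed set contains the outcome of every play on it. -/
theorem mem_of_mem_iInter (hK : IsClosed K) (hb : ∀ n, BobLegal K β b a n)
    (hr : Filter.Tendsto (fun n => (b n).2) Filter.atTop (nhds 0))
    {z : EuclideanSpace ℝ (Fin d)} (hz : z ∈ ⋂ n, (b n).set) : z ∈ K := by
  refine hK.mem_of_tendsto (b := Filter.atTop) (f := fun n => (b n).1) ?_
    (Filter.Eventually.of_forall fun n => bob_center_mem n (hb n))
  rw [tendsto_iff_dist_tendsto_zero]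
  refine squeeze_zero (fun _ => dist_nonneg) (fun n => ?_) hr
  rw [dist_comm]
  exact mem_iInter.1 hz n

open Classical in
/-- The move that a positional strategy with invariant `I` makes in reply to the ball `B`. -/
noncomputable def positionalMove (K : Set (EuclideanSpace ℝ (Fin d))) (α γ : ℝ)
    (I : EuclideanSpace ℝ (Fin d) → ℝ → Prop) (B : GameBall d) : GameBall d :=
  (if h : ∃ x' ∈ K, closedBall x' (α * B.2) ⊆ closedBall B.1 B.2 ∧
      ∀ x'', closedBall x'' (γ * B.2) ⊆ closedBall x' (α * B.2) → I x'' (γ * B.2)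
    then h.choose else B.1, α * B.2)

theorem positionalMove_legal {γ : ℝ} (hα1 : α < 1) (I : EuclideanSpace ℝ (Fin d) → ℝ → Prop)
    {B : GameBall d} (hB : B.1 ∈ K) (hB0 : 0 < B.2) :
    (positionalMove K α γ I B).1 ∈ K ∧ (positionalMove K α γ I B).set ⊆ B.set := by
  simp only [positionalMove, GameBall.set]
  split_ifs with h
  · exact ⟨h.choose_spec.1, h.choose_spec.2.1⟩
  · exact ⟨hB, closedBall_subset_closedBall (by nlinarith)⟩

theorem positionalMove_spec {γ : ℝ} {I : EuclideanSpace ℝ (Fin d) → ℝ → Prop} {B : GameBall d}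
    (h : ∃ x' ∈ K, closedBall x' (α * B.2) ⊆ closedBall B.1 B.2 ∧
      ∀ x'', closedBall x'' (γ * B.2) ⊆ closedBall x' (α * B.2) → I x'' (γ * B.2))
    {x'' : EuclideanSpace ℝ (Fin d)}
    (hx : closedBall x'' (γ * B.2) ⊆ (positionalMove K α γ I B).set) : I x'' (γ * B.2) := by
  simp only [positionalMove, GameBall.set, dif_pos h] at hx
  exact h.choose_spec.2.2 x'' hx

open Classical in
/-- The strategy that waits until Bob's ball lies in `U`, and from then on plays the `i`-th of
countably many positional strategies, with invariants depending on Bob's first ball in `U`,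
at the turns `n` for which `2 ^ i` exactly divides `n + 1`. -/
noncomputable def interleavedStrategy (K U : Set (EuclideanSpace ℝ (Fin d))) (α : ℝ) (γ : ℕ → ℝ)
    (I : GameBall d → ℕ → EuclideanSpace ℝ (Fin d) → ℝ → Prop) : AliceStrategy d :=
  fun n h =>
    if hm : ∃ m : Fin (n + 1), (h m).set ⊆ U ∧ ∀ k < m, ¬ (h k).set ⊆ U then
      positionalMove K α (γ (padicValNat 2 (n - hm.choose + 1)))
        (I (h hm.choose) (padicValNat 2 (n - hm.choose + 1))) (h (Fin.last n))
    -- A waiting move: only its legality matters.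
    else positionalMove K α 1 (fun _ _ => False) (h (Fin.last n))

variable {U : Set (EuclideanSpace ℝ (Fin d))} {γ : ℕ → ℝ}
  {I : GameBall d → ℕ → EuclideanSpace ℝ (Fin d) → ℝ → Prop}

theorem interleavedStrategy_radius (b : ℕ → GameBall d) (n : ℕ) :
    ((interleavedStrategy K U α γ I).reply b n).2 = α * (b n).2 := by
  simp only [AliceStrategy.reply, interleavedStrategy]
  split_ifs <;> simp [positionalMove]

theorem interleavedStrategy_legal (hα1 : α < 1) (b : ℕ → GameBall d) (n : ℕ) (hb : (b n).1 ∈ K)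
    (hb0 : 0 < (b n).2) : AliceLegal K α b ((interleavedStrategy K U α γ I).reply b) n := by
  have h : ((interleavedStrategy K U α γ I).reply b n).1 ∈ K ∧
      ((interleavedStrategy K U α γ I).reply b n).set ⊆ (b n).set := by
    simp only [AliceStrategy.reply, interleavedStrategy]
    split_ifs <;> exact positionalMove_legal hα1 _ hb hb0
  exact ⟨h.1, interleavedStrategy_radius b n, h.2⟩

theorem interleavedStrategy_reply {b : ℕ → GameBall d} {m₀ t i k : ℕ} (h1 : (b m₀).set ⊆ U)
    (h2 : ∀ k < m₀, ¬ (b k).set ⊆ U) (ht : t + 1 = 2 ^ i * (2 * k + 1)) :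
    (interleavedStrategy K U α γ I).reply b (m₀ + t) =
      positionalMove K α (γ i) (I (b m₀) i) (b (m₀ + t)) := by
  have hm : ∃ m : Fin (m₀ + t + 1), (b m).set ⊆ U ∧ ∀ k < m, ¬ (b k).set ⊆ U :=
    ⟨⟨m₀, by omega⟩, h1, fun k hk => h2 k hk⟩
  have hch : (hm.choose : ℕ) = m₀ := by
    have hs := hm.choose_spec
    rcases lt_trichotomy (hm.choose : ℕ) m₀ with h | h | h
    · exact absurd hs.1 (h2 _ h)
    · exact h
    · exact absurd h1 (hs.2 ⟨m₀, by omega⟩ h)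
  have hval : padicValNat 2 (m₀ + t - hm.choose + 1) = i := by
    have h3 : padicValNat 2 (2 * k + 1) = 0 := padicValNat.eq_zero_of_not_dvd (by omega)
    rw [hch, Nat.add_sub_cancel_left, ht, padicValNat.mul (by positivity) (by omega),
      padicValNat.prime_pow, h3, add_zero]
  simp only [AliceStrategy.reply, interleavedStrategy]
  rw [dif_pos hm, hval, hch]
  rfl

/-- Countably many positionally winning sets have a winning intersection. -/
theorem isWinningOn_of_isPositionallyWinningOn (hK : IsClosed K) (hα0 : 0 < α) (hα1 : α < 1)
    (hU : IsOpen U) {T : ℕ → Set (EuclideanSpace ℝ (Fin d))}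
    (hT : ∀ i p R, closedBall p R ⊆ U → IsPositionallyWinningOn K α (closedBall p R) (T i)) :
    IsWinningOn K (K ∩ ({x | x ∈ U ∧ ∀ i, x ∈ T i} ∪ Uᶜ)) := by
  refine ⟨α, hα0, hα1, fun β hβ0 hβ1 => ?_⟩
  have hαβ0 : 0 < α * β := by positivity
  have hαβ1 : α * β < 1 := by nlinarith
  -- Turns `t` with `t + 1 = 2 ^ i * (2 * k + 1)` start at `2 ^ i - 1` and recur every `2 ^ (i + 1)`
  -- moves, so the `i`-th strategy sees this fixed ratio of radii.
  let γ : ℕ → ℝ := fun i => (α * β) ^ 2 ^ (i + 1)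
  -- An invariant is fixed in advance for every possible first ball `P` inside `U`, since uniform
  -- constants for `f i` exist only on balls contained in `U`.
  have hinv : ∀ (P : GameBall d) (i : ℕ), ∃ I : EuclideanSpace ℝ (Fin d) → ℝ → Prop,
      P.set ⊆ U → 0 < P.2 → (∀ x, I x (P.2 * (α * β) ^ (2 ^ i - 1))) ∧
      (∀ x ∈ K, ∀ r, 0 < r → closedBall x r ⊆ P.set → I x r →
        ∃ x' ∈ K, closedBall x' (α * r) ⊆ closedBall x r ∧
          ∀ x'', closedBall x'' (γ i * r) ⊆ closedBall x' (α * r) → I x'' (γ i * r)) ∧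
      ∀ z ∈ P.set, (∀ ε > 0, ∃ x r, 0 < r ∧ r < ε ∧ z ∈ closedBall x r ∧ I x r) → z ∈ T i := by
    intro P i
    by_cases hP : P.set ⊆ U ∧ 0 < P.2
    · have hR : 0 < P.2 * (α * β) ^ (2 ^ i - 1) := mul_pos hP.2 (by positivity)
      obtain ⟨I, hI⟩ := hT i P.1 P.2 hP.1 (γ i) _ (by positivity)
        (pow_lt_one₀ hαβ0.le hαβ1 (by positivity)) hR
      exact ⟨I, fun _ _ => hI⟩
    · exact ⟨fun _ _ => False, fun h1 h2 => absurd ⟨h1, h2⟩ hP⟩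
  choose I hI using hinv
  refine ⟨interleavedStrategy K U α γ I, fun b => ?_⟩
  set a := (interleavedStrategy K U α γ I).reply b with ha
  have harad : ∀ m, (a m).2 = α * (b m).2 := fun m => interleavedStrategy_radius b m
  have hbpos : ∀ n, (∀ m ≤ n, BobLegal K β b a m) → 0 < (b n).2 := fun n hn => by
    rw [bob_radius n hn harad]
    exact mul_pos (hn 0 (by omega)).2 (by positivity)
  refine ⟨fun n hn => interleavedStrategy_legal hα1 b n (bob_center_mem n (hn n le_rfl))
    (hbpos n hn), fun hb z hz => ?_⟩
  have hpos : ∀ n, 0 < (b n).2 := fun n => hbpos n fun m _ => hb m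
  have hrad : ∀ n, (b n).2 = (b 0).2 * (α * β) ^ n := fun n =>
    bob_radius n (fun m _ => hb m) harad
  have hrtend : Filter.Tendsto (fun n => (b n).2) Filter.atTop (nhds 0) := by
    rw [show (fun n => (b n).2) = fun n => (b 0).2 * (α * β) ^ n from funext hrad]
    simpa using (tendsto_pow_atTop_nhds_zero_of_lt_one hαβ0.le hαβ1).const_mul (b 0).2
  have hasub : ∀ n, (a n).set ⊆ (b n).set := fun n =>
    (interleavedStrategy_legal hα1 b n (bob_center_mem n (hb n)) (hpos n)).2.2
  have hanti := bob_antitone hb hasub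
  have hzb : ∀ n, z ∈ (b n).set := mem_iInter.1 hz
  refine ⟨mem_of_mem_iInter hK hb hrtend hz, ?_⟩
  by_cases hzU : z ∈ U
  swap
  · exact Or.inr hzU
  left
  have hex : ∃ n, (b n).set ⊆ U := by
    obtain ⟨ε, hε, hεU⟩ := Metric.isOpen_iff.1 hU z hzU
    obtain ⟨n, hn⟩ := (hrtend.eventually (gt_mem_nhds (half_pos hε))).exists
    refine ⟨n, fun w hw => hεU ?_⟩
    have h1 : dist w (b n).1 ≤ (b n).2 := hw
    have h2 : dist z (b n).1 ≤ (b n).2 := hzb n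
    rw [mem_ball]
    linarith [dist_triangle_right w z (b n).1]
  classical
  set m₀ := Nat.find hex
  have hm₀ : (b m₀).set ⊆ U := Nat.find_spec hex
  have hmin : ∀ k < m₀, ¬ (b k).set ⊆ U := fun k hk => Nat.find_min hex hk
  refine ⟨hzU, fun i => ?_⟩
  obtain ⟨hI0, hIstep, hIend⟩ := hI (b m₀) i hm₀ (hpos m₀)
  have hstage : ∀ k t, t + 1 = 2 ^ i * (2 * k + 1) → I (b m₀) i (b (m₀ + t)).1 (b (m₀ + t)).2 := by
    intro k
    induction k with
    | zero =>
      intro t ht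
      have : (b (m₀ + t)).2 = (b m₀).2 * (α * β) ^ (2 ^ i - 1) := by
        rw [hrad (m₀ + t), hrad m₀, pow_add]
        have : t = 2 ^ i - 1 := by omega
        rw [this]; ring
      rw [this]
      exact hI0 _
    | succ k ih =>
      intro t ht
      obtain ⟨t', rfl⟩ : ∃ t', t = t' + 2 ^ (i + 1) := by
        refine ⟨t - 2 ^ (i + 1), (Nat.sub_add_cancel ?_).symm⟩
        have := Nat.one_le_two_pow (n := i)
        rw [pow_succ]
        nlinarith
      have ht' : t' + 1 = 2 ^ i * (2 * k + 1) := by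
        have : 2 ^ i * (2 * (k + 1) + 1) = 2 ^ i * (2 * k + 1) + 2 ^ (i + 1) := by ring
        omega
      have hmove := interleavedStrategy_reply (K := K) (α := α) (γ := γ) (I := I) hm₀ hmin ht'
      have hr : (b (m₀ + (t' + 2 ^ (i + 1)))).2 = γ i * (b (m₀ + t')).2 := by
        rw [hrad, hrad (m₀ + t'), ← add_assoc, pow_add _ (m₀ + t')]
        ring
      -- Moves made between two turns of the `i`-th strategy do no harm: balls are nested, so its
      -- next ball still lies in its last reply.
      have hsub : (b (m₀ + (t' + 2 ^ (i + 1)))).set ⊆ (a (m₀ + t')).set := by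
        have h3 : m₀ + t' + 1 ≤ m₀ + (t' + 2 ^ (i + 1)) := by
          have := Nat.one_le_two_pow (n := i + 1)
          omega
        exact (hanti h3).trans (hb (m₀ + t' + 1)).2.2
      rw [ha, hmove] at hsub
      rw [hr]
      refine positionalMove_spec (hIstep _ (bob_center_mem _ (hb _)) _ (hpos _)
        (hanti (Nat.le_add_right _ _)) (ih t' ht')) ?_
      rw [← hr]
      exact hsub
  refine hIend z (hzb m₀) fun ε hε => ?_
  obtain ⟨n₀, hn₀⟩ := Filter.eventually_atTop.1 (hrtend.eventually (gt_mem_nhds hε))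
  -- Taking `k = n₀` gives a turn of the `i`-th strategy late enough for the radius to be below `ε`.
  have hbig : n₀ ≤ 2 ^ i * (2 * n₀ + 1) - 1 := by
    have := Nat.one_le_two_pow (n := i)
    have : 1 * (2 * n₀ + 1) ≤ 2 ^ i * (2 * n₀ + 1) := Nat.mul_le_mul_right _ this
    omega
  have hge : 1 ≤ 2 ^ i * (2 * n₀ + 1) := Nat.mul_pos (by positivity) (by omega)
  exact ⟨_, _, hpos _, hn₀ (m₀ + (2 ^ i * (2 * n₀ + 1) - 1)) (by omega), hzb _,
    hstage n₀ _ (Nat.sub_add_cancel hge)⟩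

end Game

/-! ### Dimension bounds from branching plays. -/

section Tree

variable {d m : ℕ}

/-- Bob's play against `σ` in which, after Alice's `n`-th ball `A`, he picks the point with index
`ω n` among the `m` points `q A`. -/
noncomputable def treePlay (σ : AliceStrategy d) (β : ℝ)
    (q : GameBall d → Fin m → EuclideanSpace ℝ (Fin d)) (B : GameBall d) (ω : ℕ → Fin m) :
    ℕ → GameBall d
  | 0 => B
  | n + 1 => (q (σ n fun i : Fin (n + 1) => treePlay σ β q B ω i) (ω n),
      β * (σ n fun i : Fin (n + 1) => treePlay σ β q B ω i).2)
termination_by n => n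
decreasing_by all_goals exact i.2

variable {σ : AliceStrategy d} {β : ℝ} {q : GameBall d → Fin m → EuclideanSpace ℝ (Fin d)}
  {B : GameBall d}

theorem treePlay_zero (ω : ℕ → Fin m) : treePlay σ β q B ω 0 = B := by
  rw [treePlay]

theorem treePlay_succ (ω : ℕ → Fin m) (n : ℕ) :
    treePlay σ β q B ω (n + 1) = (q (σ.reply (treePlay σ β q B ω) n) (ω n),
      β * (σ.reply (treePlay σ β q B ω) n).2) := by
  rw [treePlay]; rfl

/-- Bob's move `k` reads only the digits before `k`, so plays with a common prefix of digits share
their initial moves and Alice's replies to them. -/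
theorem treePlay_congr {ω ω' : ℕ → Fin m} {n : ℕ} (h : ∀ k < n, ω k = ω' k) :
    ∀ k ≤ n, treePlay σ β q B ω k = treePlay σ β q B ω' k := by
  intro k
  induction k using Nat.strong_induction_on with
  | _ k ih =>
    intro hk
    cases k with
    | zero => rw [treePlay_zero, treePlay_zero]
    | succ k =>
      have hrep : σ.reply (treePlay σ β q B ω) k = σ.reply (treePlay σ β q B ω') k := by
        simp only [AliceStrategy.reply]
        congr 1
        funext i
        exact ih i i.2 (by omega)
      rw [treePlay_succ, treePlay_succ, hrep, h k (by omega)]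

/-- If every ball centred on `K` contains `m` well separated smaller balls centred on `K`, then
winning sets on `K` are large. -/
theorem IsAlphaBetaWinningOn.le_dimH {K S : Set (EuclideanSpace ℝ (Fin d))} {α β : ℝ} (hα0 : 0 < α)
    (hα1 : α < 1) (hβ0 : 0 < β) (hβ1 : β < 1) (hS : IsAlphaBetaWinningOn K α β S)
    {p : EuclideanSpace ℝ (Fin d)} (hp : p ∈ K) {R : ℝ} (hR : 0 < R) {m : ℕ} (hm : 1 < m)
    {s : NNReal} (hs : 0 < s) (hms : (m : ℝ)⁻¹ ≤ (α * β) ^ (s : ℝ))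
    (hsep : ∀ x ∈ K, ∀ ρ, 0 < ρ → ρ ≤ R → ∃ q : Fin m → EuclideanSpace ℝ (Fin d),
      (∀ i, q i ∈ K ∧ dist (q i) x ≤ (1 - β) * ρ) ∧
        ∀ i j, i ≠ j → 3 * (β * ρ) ≤ dist (q i) (q j)) :
    (s : ENNReal) ≤ dimH (S ∩ closedBall p R) := by
  obtain ⟨σ, hσ⟩ := hS
  have hsep' : ∀ A : GameBall d, ∃ q : Fin m → EuclideanSpace ℝ (Fin d),
      A.1 ∈ K → 0 < A.2 → A.2 ≤ R → (∀ i, q i ∈ K ∧ dist (q i) A.1 ≤ (1 - β) * A.2) ∧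
        ∀ i j, i ≠ j → 3 * (β * A.2) ≤ dist (q i) (q j) := by
    intro A
    by_cases h : A.1 ∈ K ∧ 0 < A.2 ∧ A.2 ≤ R
    · obtain ⟨q, hq⟩ := hsep A.1 h.1 A.2 h.2.1 h.2.2
      exact ⟨q, fun _ _ _ => hq⟩
    · exact ⟨fun _ => 0, fun h1 h2 h3 => absurd ⟨h1, h2, h3⟩ h⟩
  choose q hq using hsep'
  let b : (ℕ → Fin m) → ℕ → GameBall d := fun ω => treePlay σ β q (p, R) ω
  have hlegal' : ∀ ω n, (∀ k ≤ n, BobLegal K β (b ω) (σ.reply (b ω)) k) ∧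
      0 < (b ω n).2 ∧ (b ω n).2 ≤ R := by
    intro ω n
    induction n with
    | zero =>
      have h0 : b ω 0 = (p, R) := treePlay_zero ω
      refine ⟨fun k hk => ?_, by rw [h0]; exact hR, by rw [h0]⟩
      obtain rfl : k = 0 := by omega
      simp only [BobLegal, h0]
      exact ⟨hp, hR⟩
    | succ n ih =>
      obtain ⟨hleg, hpos, hle⟩ := ih
      obtain ⟨ha1, ha2, ha3⟩ := (hσ (b ω)).1 n hleg
      have hapos : 0 < (σ.reply (b ω) n).2 := by rw [ha2]; positivity
      have haR : (σ.reply (b ω) n).2 ≤ R := by rw [ha2]; nlinarith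
      have hsucc : b ω (n + 1) = _ := treePlay_succ ω n
      obtain ⟨hq1, -⟩ := hq _ ha1 hapos haR
      refine ⟨fun k hk => ?_, by rw [hsucc]; exact mul_pos hβ0 hapos, ?_⟩
      · rcases Nat.lt_or_ge n k with h | h
        · obtain rfl : k = n + 1 := by omega
          simp only [BobLegal]
          rw [hsucc]
          refine ⟨(hq1 _).1, rfl, closedBall_subset_closedBall' ?_⟩
          have := (hq1 (ω n)).2
          change β * (σ.reply (b ω) n).2 + dist (q (σ.reply (b ω) n) (ω n)) _ ≤ _
          linarith
        · exact hleg k h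
      · rw [hsucc]
        change β * (σ.reply (b ω) n).2 ≤ R
        nlinarith
  have hbob : ∀ ω n, BobLegal K β (b ω) (σ.reply (b ω)) n := fun ω n => (hlegal' ω n).1 n le_rfl
  have halice : ∀ ω n, AliceLegal K α (b ω) (σ.reply (b ω)) n := fun ω n =>
    (hσ (b ω)).1 n fun k _ => hbob ω k
  have hpos : ∀ ω n, 0 < (b ω n).2 := fun ω n => (hlegal' ω n).2.1
  have hb0 : ∀ ω, b ω 0 = (p, R) := fun ω => treePlay_zero ω
  have hrad : ∀ ω n, (b ω n).2 = R * (α * β) ^ n := fun ω n => by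
    rw [bob_radius n (fun k _ => hbob ω k) (fun k => (halice ω k).2.1), hb0]
  have hne : ∀ ω, (⋂ n, (b ω n).set).Nonempty := by
    intro ω
    refine IsCompact.nonempty_iInter_of_sequence_nonempty_isCompact_isClosed _ (fun n => ?_)
      (fun n => ?_) (isCompact_closedBall _ _) (fun n => isClosed_closedBall)
    · exact (hbob ω (n + 1)).2.2.trans (halice ω n).2.2
    · exact ⟨_, mem_closedBall_self (hpos ω n).le⟩
  choose z hz using hne
  -- At the first differing digit the two centres are `3 * β * ρ` apart, `ρ` being the radius of
  -- Alice's common ball. Each outcome is within `β * ρ` of its centre, which leaves a gap of `β *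
  -- ρ`.
  have hsepz : ∀ ω ω' : ℕ → Fin m, ω ≠ ω' →
      R * (α * β) ^ (PiNat.firstDiff ω ω' + 1) ≤ dist (z ω) (z ω') := by
    intro ω ω' hne
    set n := PiNat.firstDiff ω ω' with hn
    have hagree : ∀ k < n, ω k = ω' k := fun k hk => PiNat.apply_eq_of_lt_firstDiff hk
    have hdiff : ω n ≠ ω' n := PiNat.apply_firstDiff_ne hne
    have hrep : σ.reply (b ω') n = σ.reply (b ω) n := by
      simp only [AliceStrategy.reply]
      congr 1
      funext i
      exact (treePlay_congr hagree i (by omega)).symm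
    obtain ⟨ha1, ha2, -⟩ := halice ω n
    have hapos : 0 < (σ.reply (b ω) n).2 := by rw [ha2]; exact mul_pos hα0 (hpos ω n)
    have haR : (σ.reply (b ω) n).2 ≤ R := by
      rw [ha2]; nlinarith [(hlegal' ω n).2.2, hpos ω n]
    have hd := (hq _ ha1 hapos haR).2 _ _ hdiff
    have h1 : dist (z ω) (q (σ.reply (b ω) n) (ω n)) ≤ β * (σ.reply (b ω) n).2 := by
      have := mem_iInter.1 (hz ω) (n + 1)
      rw [show b ω (n + 1) = _ from treePlay_succ ω n] at this
      exact this
    have h2 : dist (z ω') (q (σ.reply (b ω) n) (ω' n)) ≤ β * (σ.reply (b ω) n).2 := by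
      have := mem_iInter.1 (hz ω') (n + 1)
      rw [show b ω' (n + 1) = _ from treePlay_succ ω' n] at this
      change dist _ (q (σ.reply (b ω') n) _) ≤ β * (σ.reply (b ω') n).2 at this
      rwa [hrep] at this
    have h3 : R * (α * β) ^ (n + 1) = β * (σ.reply (b ω) n).2 := by
      rw [ha2, hrad, pow_succ]; ring
    rw [h3]
    have h4 := dist_triangle4 (q (σ.reply (b ω) n) (ω n)) (z ω) (z ω')
      (q (σ.reply (b ω) n) (ω' n))
    rw [dist_comm _ (z ω)] at h4
    linarith
  have hinj : Function.Injective z := by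
    intro ω ω' h
    by_contra hne
    have := hsepz ω ω' hne
    rw [h, dist_self] at this
    have : 0 < R * (α * β) ^ (PiNat.firstDiff ω ω' + 1) := by positivity
    linarith
  have : NeZero m := ⟨by omega⟩
  have hleft := Function.leftInverse_invFun hinj
  -- Read the digits of an outcome as a base `m` expansion: `g` maps onto `[0, 1]`, and `m⁻¹ ≤ (α *
  -- β) ^ s` makes it Hölder of exponent `s`.
  set g : EuclideanSpace ℝ (Fin d) → ℝ := fun x => Real.ofDigits (Function.invFun z x) with hg
  have hgz : ∀ ω, g (z ω) = Real.ofDigits ω := fun ω => by rw [hg]; simp only [hleft ω]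
  have hC0 : (0 : ℝ) ≤ m * R ^ (-(s : ℝ)) := by positivity
  have hholder : HolderOnWith (m * R ^ (-(s : ℝ))).toNNReal s g (range z) := by
    rintro _ ⟨ω, rfl⟩ _ ⟨ω', rfl⟩
    rcases eq_or_ne ω ω' with rfl | hne
    · simp
    rw [hgz, hgz, edist_dist, edist_dist, ENNReal.ofReal_rpow_of_nonneg dist_nonneg s.coe_nonneg]
    change _ ≤ ENNReal.ofReal (m * R ^ (-(s : ℝ))) * _
    rw [← ENNReal.ofReal_mul hC0]
    apply ENNReal.ofReal_le_ofReal
    set n := PiNat.firstDiff ω ω' with hn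
    have hm0 : (0 : ℝ) < m := by positivity
    calc dist (Real.ofDigits ω) (Real.ofDigits ω')
        ≤ ((m : ℝ) ^ n)⁻¹ := by
          rw [Real.dist_eq]
          exact Real.abs_ofDigits_sub_ofDigits_le fun k hk =>
            PiNat.apply_eq_of_lt_firstDiff hk
      _ = m * (m : ℝ)⁻¹ ^ (n + 1) := by rw [pow_succ, inv_pow]; field_simp
      _ ≤ m * ((α * β) ^ (s : ℝ)) ^ (n + 1) := by gcongr
      _ = m * R ^ (-(s : ℝ)) * (R * (α * β) ^ (n + 1)) ^ (s : ℝ) := by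
          rw [Real.mul_rpow hR.le (by positivity), ← Real.rpow_natCast, ← Real.rpow_natCast,
            ← Real.rpow_mul (by positivity), ← Real.rpow_mul (by positivity), mul_comm (s : ℝ),
            Real.rpow_neg hR.le]
          field_simp
      _ ≤ m * R ^ (-(s : ℝ)) * dist (z ω) (z ω') ^ (s : ℝ) := by
          gcongr
          exact hsepz ω ω' hne
  have himg : Icc (0 : ℝ) 1 ⊆ g '' range z := by
    intro t ht
    obtain ⟨ω, -, hω⟩ := Real.ofDigits_SurjOn hm ht
    exact ⟨z ω, mem_range_self ω, by rw [hgz, hω]⟩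
  have hdim := (dimH_mono himg).trans (hholder.dimH_image_le hs)
  rw [Real.dimH_of_nonempty_interior (by rw [interior_Icc]; exact nonempty_Ioo.2 one_pos),
    Module.finrank_self, Nat.cast_one, ENNReal.le_div_iff_mul_le
      (Or.inl (by exact_mod_cast hs.ne')) (Or.inl ENNReal.coe_ne_top), one_mul] at hdim
  refine hdim.trans (dimH_mono ?_)
  rintro _ ⟨ω, rfl⟩
  refine ⟨(hσ (b ω)).2 (hbob ω) (hz ω), ?_⟩
  have := mem_iInter.1 (hz ω) 0
  rw [hb0] at this
  exact this

end Tree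

/-! ### Packing and covering for Ahlfors regular measures. -/

section Ahlfors

variable {d : ℕ}

/-- Greedy choice: a separated set that cannot be enlarged is a net. -/
theorem exists_separated_or_net {X : Type*} [PseudoMetricSpace X] (D : Set X) {ρ : ℝ} (m : ℕ) :
    (∃ F : Finset X, (F : Set X) ⊆ D ∧ (F : Set X).Pairwise (fun x y => ρ ≤ dist x y) ∧
      F.card = m) ∨
    ∃ F : Finset X, (F : Set X) ⊆ D ∧ (F : Set X).Pairwise (fun x y => ρ ≤ dist x y) ∧
      F.card < m ∧ ∀ x ∈ D, x ∈ F ∨ ∃ y ∈ F, dist x y < ρ := by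
  classical
  induction m with
  | zero => exact Or.inl ⟨∅, by simp, by simp, rfl⟩
  | succ m ih =>
    rcases ih with ⟨F, hFD, hF, hc⟩ | ⟨F, hFD, hF, hc, hnet⟩
    · by_cases h : ∀ x ∈ D, x ∈ F ∨ ∃ y ∈ F, dist x y < ρ
      · exact Or.inr ⟨F, hFD, hF, by omega, h⟩
      · push Not at h
        obtain ⟨x, hxD, hxF, hx⟩ := h
        refine Or.inl ⟨insert x F, ?_, ?_, by rw [Finset.card_insert_of_notMem hxF, hc]⟩
        · rw [Finset.coe_insert]; exact insert_subset hxD hFD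
        · rw [Finset.coe_insert]
          refine hF.insert fun y hy _ => ⟨hx y hy, ?_⟩
          rw [dist_comm]; exact hx y hy
    · exact Or.inr ⟨F, hFD, hF, by omega, hnet⟩

/-- The support of a `δ`-Ahlfors regular measure has dimension at most `δ`. -/
theorem IsAhlforsRegularWith.dimH_support_le {δ : ℝ} {μ : Measure (EuclideanSpace ℝ (Fin d))}
    (hμ : IsAhlforsRegularWith δ μ) {t : NNReal} (ht : δ < t) : dimH μ.support ≤ t := by
  obtain ⟨hfin, c₁, c₂, ρ₀, hc₁, -, hρ₀, hreg⟩ := hμ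
  have hcover : μ.support = ⋃ n : ℕ, μ.support ∩ closedBall 0 n := by
    rw [← inter_iUnion, iUnion_closedBall_nat, inter_univ]
  rw [hcover, dimH_iUnion]
  refine iSup_le fun n => dimH_le_of_hausdorffMeasure_ne_top ?_
  set D := μ.support ∩ closedBall (0 : EuclideanSpace ℝ (Fin d)) n with hD
  set V := (μ (closedBall 0 (n + 1))).toReal with hV
  have hVfin : μ (closedBall 0 (n + 1)) < ⊤ := (isCompact_closedBall _ _).measure_lt_top
  -- Packing: balls of radius `ρ / 3` about `ρ`-separated points of `D` are disjoint and lie in the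
  -- ball of radius `n + 1`.
  have hcard : ∀ ρ, 0 < ρ → ρ < ρ₀ → ρ < 1 → ∀ F : Finset (EuclideanSpace ℝ (Fin d)),
      (F : Set (EuclideanSpace ℝ (Fin d))) ⊆ D →
      (F : Set (EuclideanSpace ℝ (Fin d))).Pairwise (fun x y => ρ ≤ dist x y) →
      F.card * (c₁ * (ρ / 3) ^ δ) ≤ V := by
    intro ρ hρ hρ' hρ1 F hFD hF
    have hdisj : (F : Set (EuclideanSpace ℝ (Fin d))).PairwiseDisjoint
        (fun y => closedBall y (ρ / 3)) := fun x hx y hy hxy =>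
      closedBall_disjoint_closedBall (by have := hF hx hy hxy; linarith)
    have h1 : ∑ y ∈ F, μ (closedBall y (ρ / 3)) ≤ μ (closedBall 0 (n + 1)) := by
      rw [← measure_biUnion_finset hdisj fun _ _ => measurableSet_closedBall]
      refine measure_mono (iUnion₂_subset fun y hy => closedBall_subset_closedBall' ?_)
      have : dist y 0 ≤ n := (hFD hy).2
      linarith
    have h2 : ∑ y ∈ F, ENNReal.ofReal (c₁ * (ρ / 3) ^ δ) ≤ ∑ y ∈ F, μ (closedBall y (ρ / 3)) :=
      Finset.sum_le_sum fun y hy =>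
        (hreg y (hFD hy).1 (ρ / 3) (by positivity) (by linarith)).1
    have h3 := h2.trans h1
    rw [Finset.sum_const, nsmul_eq_mul, ← ENNReal.ofReal_natCast,
      ← ENNReal.ofReal_mul (Nat.cast_nonneg _)] at h3
    exact (ENNReal.ofReal_le_iff_le_toReal hVfin.ne).1 h3
  have hex : ∀ ρ : ℝ, ∃ F : Finset (EuclideanSpace ℝ (Fin d)), 0 < ρ → ρ < ρ₀ → ρ < 1 →
      F.card * (c₁ * (ρ / 3) ^ δ) ≤ V ∧ D ⊆ ⋃ y : F, closedBall (y : EuclideanSpace ℝ (Fin d)) ρ := by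
    intro ρ
    by_cases h : 0 < ρ ∧ ρ < ρ₀ ∧ ρ < 1
    swap
    · exact ⟨∅, fun h1 h2 h3 => absurd ⟨h1, h2, h3⟩ h⟩
    obtain ⟨h0, h1, h2⟩ := h
    have hpos : 0 < c₁ * (ρ / 3) ^ δ := by positivity
    -- One point more than the packing bound allows, so the greedy choice must end in a net.
    rcases exists_separated_or_net D (ρ := ρ) (⌊V / (c₁ * (ρ / 3) ^ δ)⌋₊ + 1) with
      ⟨F, hFD, hF, hc⟩ | ⟨F, hFD, hF, -, hnet⟩
    · have h3 := hcard ρ h0 h1 h2 F hFD hF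
      rw [← le_div_iff₀ hpos, hc] at h3
      push_cast at h3
      exact absurd (Nat.lt_floor_add_one _) (not_lt.2 h3)
    · refine ⟨F, fun _ _ _ => ⟨hcard ρ h0 h1 h2 F hFD hF, fun x hx => mem_iUnion.2 ?_⟩⟩
      rcases hnet x hx with h | ⟨y, hy, hxy⟩
      · exact ⟨⟨x, h⟩, mem_closedBall_self h0.le⟩
      · exact ⟨⟨y, hy⟩, hxy.le⟩
  choose F hF using hex
  have hsmall : ∀ᶠ ρ : ℝ in nhdsWithin 0 (Ioi 0), 0 < ρ ∧ ρ < ρ₀ ∧ ρ < 1 := by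
    have h1 : Ioo (0 : ℝ) (min ρ₀ 1) ∈ nhdsWithin (0 : ℝ) (Ioi 0) :=
      Ioo_mem_nhdsGT (by positivity)
    filter_upwards [h1] with ρ hρ
    exact ⟨hρ.1, lt_min_iff.1 hρ.2⟩
  have hdiam : ∀ (ρ : ℝ) (y : EuclideanSpace ℝ (Fin d)), 0 < ρ →
      ediam (closedBall y ρ) ≤ ENNReal.ofReal (2 * ρ) := by
    intro ρ y hρ
    rw [ENNReal.ofReal_mul zero_le_two, ENNReal.ofReal_ofNat, ← closedEBall_ofReal hρ.le]
    exact ediam_closedEBall_le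
  have hle := Measure.hausdorffMeasure_le_liminf_sum (t : ℝ) D (l := nhdsWithin (0 : ℝ) (Ioi 0))
    (ι := fun ρ => F ρ) (fun ρ => ENNReal.ofReal (2 * ρ)) (by
      have : Filter.Tendsto (fun ρ : ℝ => 2 * ρ) (nhdsWithin 0 (Ioi 0)) (nhds 0) := by
        have h := (continuous_const_mul (2 : ℝ)).tendsto 0
        rw [mul_zero] at h
        exact h.mono_left nhdsWithin_le_nhds
      simpa using ENNReal.tendsto_ofReal this)
    (fun ρ y => closedBall (y : EuclideanSpace ℝ (Fin d)) ρ)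
    (hsmall.mono fun ρ hρ y => hdiam ρ y hρ.1)
    (hsmall.mono fun ρ hρ => (hF ρ hρ.1 hρ.2.1 hρ.2.2).2)
  have hlim : Filter.Tendsto (fun ρ : ℝ => ∑ y : F ρ,
      ediam (closedBall (y : EuclideanSpace ℝ (Fin d)) ρ) ^ (t : ℝ))
      (nhdsWithin 0 (Ioi 0)) (nhds 0) := by
    have hub : Filter.Tendsto (fun ρ : ℝ => ENNReal.ofReal (V / c₁ * 3 ^ δ * 2 ^ (t : ℝ) *
        ρ ^ ((t : ℝ) - δ))) (nhdsWithin 0 (Ioi 0)) (nhds 0) := by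
      have h1 : Filter.Tendsto (fun ρ : ℝ => ρ ^ ((t : ℝ) - δ)) (nhdsWithin 0 (Ioi 0)) (nhds 0) := by
        have := (Real.continuousAt_rpow_const 0 ((t : ℝ) - δ) (Or.inr (by linarith))).tendsto
        rw [Real.zero_rpow (by linarith)] at this
        exact this.mono_left nhdsWithin_le_nhds
      simpa using ENNReal.tendsto_ofReal (h1.const_mul (V / c₁ * 3 ^ δ * 2 ^ (t : ℝ)))
    refine tendsto_of_tendsto_of_tendsto_of_le_of_le' tendsto_const_nhds hub
      (Filter.Eventually.of_forall fun _ => zero_le) (hsmall.mono fun ρ hρ => ?_)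
    obtain ⟨h0, h1, h2⟩ := hρ
    have hpos : 0 < c₁ * (ρ / 3) ^ δ := by positivity
    calc ∑ y : F ρ, ediam (closedBall (y : EuclideanSpace ℝ (Fin d)) ρ) ^ (t : ℝ)
        ≤ ∑ y : F ρ, ENNReal.ofReal ((2 * ρ) ^ (t : ℝ)) := by
          refine Finset.sum_le_sum fun y _ => ?_
          rw [← ENNReal.ofReal_rpow_of_nonneg (by positivity) t.coe_nonneg]
          exact ENNReal.rpow_le_rpow (hdiam ρ y h0) t.coe_nonneg
      _ = ENNReal.ofReal ((F ρ).card * (2 * ρ) ^ (t : ℝ)) := by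
          rw [Finset.sum_const, nsmul_eq_mul, Finset.card_univ, Fintype.card_coe,
            ← ENNReal.ofReal_natCast, ← ENNReal.ofReal_mul (Nat.cast_nonneg _)]
      _ ≤ _ := by
          apply ENNReal.ofReal_le_ofReal
          have h3 := (hF ρ h0 h1 h2).1
          rw [← le_div_iff₀ hpos] at h3
          calc ((F ρ).card : ℝ) * (2 * ρ) ^ (t : ℝ)
              ≤ V / (c₁ * (ρ / 3) ^ δ) * (2 * ρ) ^ (t : ℝ) := by gcongr
            _ = _ := by
              rw [Real.div_rpow h0.le (by norm_num), Real.mul_rpow (by norm_num) h0.le,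
                Real.rpow_sub h0]
              field_simp
  rw [hlim.liminf_eq] at hle
  exact (lt_of_le_of_lt hle ENNReal.zero_lt_top).ne

/-- The support of an Ahlfors regular measure contains many separated points in each small ball. -/
theorem IsAhlforsRegularWith.exists_separated {δ : ℝ} {μ : Measure (EuclideanSpace ℝ (Fin d))}
    (hμ : IsAhlforsRegularWith δ μ) {α s : ℝ} (hα0 : 0 < α) (hα1 : α < 1) (hs : 0 < s)
    (hsδ : s < δ) :
    ∃ β ρ₁ : ℝ, ∃ m : ℕ, 0 < β ∧ β < 1 ∧ 0 < ρ₁ ∧ 1 < m ∧ (m : ℝ)⁻¹ ≤ (α * β) ^ s ∧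
      ∀ x ∈ μ.support, ∀ ρ, 0 < ρ → ρ ≤ ρ₁ → ∃ q : Fin m → EuclideanSpace ℝ (Fin d),
        (∀ i, q i ∈ μ.support ∧ dist (q i) x ≤ (1 - β) * ρ) ∧
          ∀ i j, i ≠ j → 3 * (β * ρ) ≤ dist (q i) (q j) := by
  obtain ⟨-, c₁, c₂, ρ₀, hc₁, hc₂, hρ₀, hreg⟩ := hμ
  have hδs : 0 < δ - s := by linarith
  -- With `β ^ (δ - s) ≤ η` the volume count `X` is at least `(α * β) ^ (-s)`; this is where `s < δ`
  -- is needed.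
  set η := α ^ s * c₁ / (c₂ * 6 ^ δ) with hη
  have hη0 : 0 < η := by positivity
  set β := min (1 / 2) (η ^ (1 / (δ - s))) with hβ
  have hβ0 : 0 < β := by positivity
  have hβ2 : β ≤ 1 / 2 := min_le_left _ _
  have hβη : β ^ (δ - s) ≤ η := by
    calc β ^ (δ - s) ≤ (η ^ (1 / (δ - s))) ^ (δ - s) := by
          gcongr
          exact min_le_right _ _
      _ = η := by rw [← Real.rpow_mul hη0.le, one_div_mul_cancel hδs.ne', Real.rpow_one]
  set X := c₁ / c₂ * (6 * β) ^ (-δ) with hX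
  have hX0 : 0 < X := by positivity
  have hXle : ((α * β) ^ s)⁻¹ ≤ X := by
    rw [inv_le_comm₀ (by positivity) hX0, hX, Real.rpow_neg (by positivity), mul_inv, inv_inv,
      inv_div, Real.mul_rpow (by norm_num) hβ0.le, Real.mul_rpow hα0.le hβ0.le]
    rw [Real.rpow_sub hβ0, hη, div_le_div_iff₀ (by positivity) (by positivity)] at hβη
    rw [div_mul_eq_mul_div, div_le_iff₀ hc₁]
    linarith
  have hX1 : 1 < X := by
    refine lt_of_lt_of_le ?_ hXle
    rw [one_lt_inv₀ (by positivity)]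
    exact Real.rpow_lt_one (by positivity) (by nlinarith) hs
  refine ⟨β, ρ₀ / 2, ⌈X⌉₊, hβ0, by linarith, by positivity, ?_, ?_, ?_⟩
  · have := hX1.trans_le (Nat.le_ceil X)
    exact_mod_cast this
  · rw [inv_le_comm₀ (by positivity) (by positivity)]
    exact hXle.trans (Nat.le_ceil X)
  intro x hx ρ hρ hρρ
  rcases exists_separated_or_net (μ.support ∩ closedBall x (ρ / 2)) (ρ := 3 * (β * ρ)) ⌈X⌉₊ with
    ⟨F, hFD, hF, hc⟩ | ⟨F, hFD, hF, hc, hnet⟩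
  · let e := Finset.equivFinOfCardEq hc
    refine ⟨fun i => (e.symm i : EuclideanSpace ℝ (Fin d)), fun i => ?_, fun i j hij => ?_⟩
    · obtain ⟨h1, h2⟩ := hFD (e.symm i).2
      refine ⟨h1, (show dist _ _ ≤ _ from h2).trans ?_⟩
      nlinarith
    · exact hF (e.symm i).2 (e.symm j).2 fun h => hij (e.symm.injective (Subtype.ext h))
  -- A net with fewer than `X` points would cover the support in the half ball by balls of total
  -- measure below `c₁ * (ρ / 2) ^ δ`.
  · exfalso
    rw [Nat.lt_ceil] at hc
    have h1 := (hreg x hx (ρ / 2) (by positivity) (by linarith)).1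
    have h2 : μ (closedBall x (ρ / 2)) ≤ ∑ y ∈ F, μ (closedBall y (3 * (β * ρ))) := by
      have h3 : μ (closedBall x (ρ / 2)) ≤ μ (μ.support ∩ closedBall x (ρ / 2)) := by
        rw [inter_comm]
        exact (measure_inter_conull (Measure.measure_compl_support (μ := μ))).ge
      refine h3.trans ((measure_mono fun z hz => ?_).trans (measure_biUnion_finset_le F _))
      rcases hnet z hz with h | ⟨y, hy, hzy⟩
      · exact mem_biUnion h (mem_closedBall_self (by positivity))
      · exact mem_biUnion hy hzy.le
    have h4 : ∑ y ∈ F, μ (closedBall y (3 * (β * ρ)))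
        ≤ ∑ y ∈ F, ENNReal.ofReal (c₂ * (3 * (β * ρ)) ^ δ) := by
      refine Finset.sum_le_sum fun y hy => (hreg y (hFD hy).1 _ (by positivity) ?_).2
      nlinarith
    have h5 := h1.trans (h2.trans h4)
    rw [Finset.sum_const, nsmul_eq_mul, ← ENNReal.ofReal_natCast,
      ← ENNReal.ofReal_mul (Nat.cast_nonneg _), ENNReal.ofReal_le_ofReal_iff (by positivity)] at h5
    have h6 : X * (c₂ * (3 * (β * ρ)) ^ δ) = c₁ * (ρ / 2) ^ δ := by
      have h7 : 3 * (β * ρ) = (6 * β) * (ρ / 2) := by ring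
      have h8 : (6 * β) ^ δ ≠ 0 := by positivity
      rw [hX, h7, Real.mul_rpow (x := 6 * β) (by positivity) (by positivity),
        Real.rpow_neg (by positivity)]
      generalize (6 * β) ^ δ = u at h8
      field_simp
    have h7 : (F.card : ℝ) * (c₂ * (3 * (β * ρ)) ^ δ) < X * (c₂ * (3 * (β * ρ)) ^ δ) := by
      gcongr
    linarith

end Ahlfors

/-! ### Assembling the dimension statements and the theorem. -/

section Main

variable {M : ℕ}

/-- Near each of its points, a hyperplane diffuse set contains two separated points. -/
theorem IsHyperplaneDiffuse.exists_separated_pair (hM : 1 ≤ M)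
    {K : Set (EuclideanSpace ℝ (Fin M))} (hK : IsHyperplaneDiffuse K) :
    ∃ β ρ₁ : ℝ, 0 < β ∧ β < 1 ∧ 0 < ρ₁ ∧
      ∀ x ∈ K, ∀ ρ, 0 < ρ → ρ ≤ ρ₁ → ∃ q : Fin 2 → EuclideanSpace ℝ (Fin M),
        (∀ i, q i ∈ K ∧ dist (q i) x ≤ (1 - β) * ρ) ∧
          ∀ i j, i ≠ j → 3 * (β * ρ) ≤ dist (q i) (q j) := by
  obtain ⟨β, ρK, hβ0, hβ1, hρK, hfar⟩ := hK.exists_far_point hM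
  have hM' : Nonempty (Fin M) := ⟨⟨0, hM⟩⟩
  obtain ⟨n, hn⟩ := exists_ne (0 : EuclideanSpace ℝ (Fin M))
  have hn' : 0 < ‖n‖ := norm_pos_iff.2 hn
  refine ⟨β / 6, ρK, by positivity, by linarith, hρK, fun x hx ρ hρ hρρ => ?_⟩
  -- The hyperplane passes through `x`, so escaping it means moving away from `x`.
  obtain ⟨x', hx', hd, hf⟩ := hfar (ρ / 2) (by positivity) (by linarith) x hx n (inner ℝ n x) hn
  have hsep : 3 * (β / 6 * ρ) ≤ dist x' x := by
    rw [← inner_sub_right] at hf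
    have h := hf.trans_le (abs_real_inner_le_norm n (x' - x))
    rw [mul_comm ‖n‖, mul_lt_mul_iff_left₀ hn', ← dist_eq_norm] at h
    linarith
  refine ⟨![x, x'], fun i => ?_, fun i j hij => ?_⟩
  · fin_cases i
    · refine ⟨hx, ?_⟩
      change dist x x ≤ _
      rw [dist_self]
      nlinarith
    · exact ⟨hx', hd.trans (by nlinarith)⟩
  · fin_cases i <;> fin_cases j
    · exact absurd rfl hij
    · change _ ≤ dist x x'
      rw [dist_comm]; exact hsep
    · exact hsep
    · exact absurd rfl hij

/-- A lower bound for the dimension of `E ⊆ U` when `K ∩ (E ∪ Uᶜ)` is winning on `K`. -/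
theorem IsAlphaWinningOn.le_dimH_inter {K U E : Set (EuclideanSpace ℝ (Fin M))} (hU : IsOpen U)
    {α : ℝ} (hα0 : 0 < α) (hα1 : α < 1) (hwin : IsAlphaWinningOn K α (K ∩ (E ∪ Uᶜ)))
    (hne : (K ∩ U).Nonempty) {β ρ₁ : ℝ} {m : ℕ} {s : NNReal} (hs : 0 < s) (hβ0 : 0 < β)
    (hβ1 : β < 1) (hρ₁ : 0 < ρ₁) (hm : 1 < m) (hms : (m : ℝ)⁻¹ ≤ (α * β) ^ (s : ℝ))
    (hsep : ∀ x ∈ K, ∀ ρ, 0 < ρ → ρ ≤ ρ₁ → ∃ q : Fin m → EuclideanSpace ℝ (Fin M),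
      (∀ i, q i ∈ K ∧ dist (q i) x ≤ (1 - β) * ρ) ∧
        ∀ i j, i ≠ j → 3 * (β * ρ) ≤ dist (q i) (q j)) :
    (s : ENNReal) ≤ dimH (K ∩ E) := by
  obtain ⟨x, hxK, hxU⟩ := hne
  -- Bob opens with a ball inside `U`, which rules out the alternative `Uᶜ` for every outcome.
  obtain ⟨ε, hε, hεU⟩ := Metric.nhds_basis_closedBall.mem_iff.1 (hU.mem_nhds hxU)
  refine ((hwin β hβ0 hβ1).le_dimH hα0 hα1 hβ0 hβ1 hxK (lt_min hε hρ₁) hm hs hms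
    fun x hx ρ hρ hρρ => hsep x hx ρ hρ (hρρ.trans (min_le_right _ _))).trans (dimH_mono ?_)
  rintro z ⟨⟨hzK, hz⟩, hzb⟩
  exact ⟨hzK, hz.resolve_right fun h =>
    h (hεU (closedBall_subset_closedBall (min_le_left _ _) hzb))⟩

/-- Binary branching suffices: with `m = 2`, the exponent solving `(α * β) ^ s = 1 / 2` is positive.
-/
theorem IsWinningOn.dimH_inter_pos (hM : 1 ≤ M) {K U E : Set (EuclideanSpace ℝ (Fin M))}
    (hK : IsHyperplaneDiffuse K) (hU : IsOpen U) (hwin : IsWinningOn K (K ∩ (E ∪ Uᶜ)))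
    (hne : (K ∩ U).Nonempty) : 0 < dimH (K ∩ E) := by
  obtain ⟨α, hα0, hα1, hwin⟩ := hwin
  obtain ⟨β, ρ₁, hβ0, hβ1, hρ₁, hsep⟩ := hK.exists_separated_pair hM
  have hαβ0 : 0 < α * β := by positivity
  have hαβ1 : α * β < 1 := by nlinarith
  have hs : 0 < Real.logb (α * β) 2⁻¹ :=
    Real.logb_pos_of_base_lt_one hαβ0 hαβ1 (by norm_num) (by norm_num)
  have h := hwin.le_dimH_inter hU hα0 hα1 hne (s := ⟨_, hs.le⟩) hs hβ0 hβ1 hρ₁ one_lt_two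
    (by
      change _ ≤ (α * β) ^ Real.logb (α * β) 2⁻¹
      rw [Real.rpow_logb hαβ0 hαβ1.ne (by norm_num)]
      norm_num) hsep
  exact lt_of_lt_of_le (ENNReal.coe_pos.2 hs) h

theorem IsWinningOn.dimH_inter_eq {K U E : Set (EuclideanSpace ℝ (Fin M))}
    (hU : IsOpen U) (hE : E ⊆ U) (hwin : IsWinningOn K (K ∩ (E ∪ Uᶜ))) (hne : (K ∩ U).Nonempty)
    {μ : Measure (EuclideanSpace ℝ (Fin M))} (hμ : IsAhlforsRegular μ) (hμK : K = μ.support) :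
    dimH (K ∩ E) = dimH (K ∩ U) := by
  obtain ⟨α, hα0, hα1, hwin⟩ := hwin
  obtain ⟨δ, hμ⟩ := hμ
  refine le_antisymm (dimH_mono (inter_subset_inter_right K hE)) ?_
  refine le_of_forall_lt fun c hc => ?_
  obtain ⟨s, hcs, hs⟩ := ENNReal.lt_iff_exists_nnreal_btwn.1 hc
  refine hcs.trans_le ?_
  have hs0 : 0 < s := ENNReal.coe_pos.1 (bot_le.trans_lt hcs)
  -- Here the upper bound `δ` for the dimension of the support enters.
  have hsδ : (s : ℝ) < δ := by
    by_contra! h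
    obtain ⟨t, hst, ht⟩ := ENNReal.lt_iff_exists_nnreal_btwn.1 hs
    have h1 : δ < t := h.trans_lt (by exact_mod_cast hst)
    have h2 : dimH (K ∩ U) ≤ t := (dimH_mono inter_subset_left).trans (hμK ▸ hμ.dimH_support_le h1)
    exact absurd ht (not_lt.2 h2)
  obtain ⟨β, ρ₁, m, hβ0, hβ1, hρ₁, hm, hms, hsep⟩ :=
    hμ.exists_separated hα0 hα1 (NNReal.coe_pos.2 hs0) hsδ
  exact hwin.le_dimH_inter hU hα0 hα1 hne hs0 hβ0 hβ1 hρ₁ hm hms (hμK ▸ hsep)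

end Main

theorem mainTheorem4 (M N : ℕ) (hM : 1 ≤ M) (hN : 1 ≤ N) (A : Matrix (Fin M) (Fin N) ℝ)
    (K : Set (EuclideanSpace ℝ (Fin M))) (hK : IsHyperplaneDiffuse K) :
    (∀ f : ℕ → EuclideanSpace ℝ (Fin M) → EuclideanSpace ℝ (Fin M),
      (∀ i, IsC1DiffeoOn Set.univ (f i)) →
        IsWinningOn K (K ∩ pullbackInter Set.univ f (badSlice A))) ∧
    (∀ U : Set (EuclideanSpace ℝ (Fin M)), IsOpen U →
      ∀ f : ℕ → EuclideanSpace ℝ (Fin M) → EuclideanSpace ℝ (Fin M),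
        (∀ i, IsC1DiffeoOn U (f i)) →
          IsWinningOn K (K ∩ (pullbackInter U f (badSlice A) ∪ Uᶜ)) ∧
          ((K ∩ U).Nonempty → 0 < dimH (K ∩ pullbackInter U f (badSlice A))) ∧
          ((K ∩ U).Nonempty → (∃ μ : MeasureTheory.Measure (EuclideanSpace ℝ (Fin M)),
              IsAhlforsRegular μ ∧ K = μ.support) →
            dimH (K ∩ pullbackInter U f (badSlice A)) = dimH (K ∩ U))) ∧
    ((∃ μ : MeasureTheory.Measure (EuclideanSpace ℝ (Fin M)),
        IsAhlforsRegular μ ∧ K = μ.support) →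
      IsStronglyC1IncompressibleOn K (badSlice A)) := by
  -- A single `α` is fixed before `U` and the sequence `f`, as the interleaving requires.
  obtain ⟨α, hα0, hα1, hpos⟩ := hK.exists_isPositionallyWinningOn hM hN A
  have hwin : ∀ U : Set (EuclideanSpace ℝ (Fin M)), IsOpen U →
      ∀ f : ℕ → EuclideanSpace ℝ (Fin M) → EuclideanSpace ℝ (Fin M),
        (∀ i, IsC1DiffeoOn U (f i)) →
          IsWinningOn K (K ∩ (pullbackInter U f (badSlice A) ∪ Uᶜ)) := fun U hU f hf =>
    isWinningOn_of_isPositionallyWinningOn (T := fun i => {z | f i z ∈ badSlice A}) hK.1 hα0 hα1 hU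
      fun i p R hPU => hpos U hU (f i) (hf i) p R hPU
  have hdim : ∀ U : Set (EuclideanSpace ℝ (Fin M)), IsOpen U →
      ∀ f : ℕ → EuclideanSpace ℝ (Fin M) → EuclideanSpace ℝ (Fin M),
        (∀ i, IsC1DiffeoOn U (f i)) → (K ∩ U).Nonempty →
          (∃ μ : MeasureTheory.Measure (EuclideanSpace ℝ (Fin M)),
            IsAhlforsRegular μ ∧ K = μ.support) →
          dimH (K ∩ pullbackInter U f (badSlice A)) = dimH (K ∩ U) := by
    rintro U hU f hf hne ⟨μ, hμ, hμK⟩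
    exact (hwin U hU f hf).dimH_inter_eq hU (fun x hx => hx.1) hne hμ hμK
  refine ⟨fun f hf => ?_, fun U hU f hf => ⟨hwin U hU f hf,
    fun hne => (hwin U hU f hf).dimH_inter_pos hM hK hU hne, hdim U hU f hf⟩,
    fun hμ U hU hne f hf => hdim U hU f hf hne hμ⟩
  have h := hwin univ isOpen_univ f hf
  rwa [compl_univ, union_empty] at h
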